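/- Fix a constant $c\in\mathbb N$. There are a randomized one-pass streaming algorithm $\mathcal A$ (a single program for a random access machine with logarithmic cost and access to independent fair coin flips, which are read one after the other and have to be stored if they are needed again) and constants $C,d$, all depending only on $c$, such that the following holds for all integers $n\ge 1$, $k\ge 0$ and all real $0<\delta<1$, where $\mathcal A$ is given $n$, $k$ and $\lceil 1/\delta\rceil$. Let $S$ be a sequence of at most $n^c$ insertions and deletions of edges on the vertex set $\{0,\dots,n-1\}$, starting from the graph without edges, fixed in advance (independently of the coins), in which only absent edges are inserted and only present edges are deleted. Suppose that after each prefix of $S$, the current graph has a vertex cover with at most $k$ vertices. Then, when $\mathcal A$ processes $S$ update by update: 1. for every outcome of the coins, $\mathcal A$ halts, it uses at no moment more than $C\max(k,1)^2\,(1+\log(n/\delta))^d$ bits of memory (that is, $\tilde O(k^2)$ space), and after the last update it extracts its output from its memory in time at most $C\,2^{2k^2}(1+\log(n/\delta))^d$ (that is, in time $\tilde O(2^{2k^2})$); 2. with probability at least $1-\delta/n^c$ over the coins, the output is a vertex cover of the final graph with at most $k$ vertices. -/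

import Mathlib

/-! ### A random access machine with logarithmic cost, one-way coin tape and one-way output tape

The memory is a finitely supported map from addresses to natural numbers. -/

namespace StreamRAM

/-- Binary operations of the machine. -/
inductive Op
  | add | sub | mul | div | mod | and | xor | eq | lt

/-- Comparisons return `1` for true and `0` for false; subtraction is truncated. -/
def Op.val : Op → ℕ → ℕ → ℕ
  | add, a, b => a + b
  | sub, a, b => a - b
  | mul, a, b => a * b
  | div, a, b => a / b
  | mod, a, b => a % b
  | and, a, b => a &&& b
  | xor, a, b => a ^^^ b
  | eq, a, b => if a = b then 1 else 0
  | lt, a, b => if a < b then 1 else 0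

/-- Expressions: literals, the content of the cell whose address is given by an expression
(indirect addressing), and binary operations. -/
inductive Expr
  | lit (v : ℕ)
  | mem (a : Expr)
  | op (o : Op) (a b : Expr)

/-- The value of an expression in a given memory. -/
def Expr.val (M : ℕ →₀ ℕ) : Expr → ℕ
  | lit v => v
  | mem a => M (a.val M)
  | op o a b => o.val (a.val M) (b.val M)

/-- The logarithmic cost of evaluating an expression: every elementary operation costs one plus
the binary lengths of all the numbers (addresses, operands, result) that it handles. -/
def Expr.cost (M : ℕ →₀ ℕ) : Expr → ℕ
  | lit v => 1 + v.size
  | mem a => a.cost M + 1 + (a.val M).size + (M (a.val M)).size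
  | op o a b =>
      a.cost M + b.cost M + 1 + (a.val M).size + (b.val M).size + (o.val (a.val M) (b.val M)).size

/-- Programs. -/
inductive Cmd
  | skip
  /-- store the value of `e` in the cell with address `d` -/
  | assign (d e : Expr)
  /-- read the next bit of the coin tape into the cell with address `d` -/
  | flip (d : Expr)
  /-- append the value of `e` to the output tape -/
  | emit (e : Expr)
  | seq (p q : Cmd)
  /-- run `p` if the value of `e` is nonzero, and `q` otherwise -/
  | ite (e : Expr) (p q : Cmd)
  /-- run `p` as long as the value of `e` is nonzero -/
  | loop (e : Expr) (p : Cmd)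

/-- The number of bits held in memory: every nonzero cell is charged the binary lengths of its
address and of its content. -/
def memBits (M : ℕ →₀ ℕ) : ℕ := M.sum fun a v => a.size + v.size

/-- A configuration of the machine: its memory, the number of coins read so far, the output written
so far, the time used so far, and the largest number of bits used at any moment so far. -/
structure State where
  mem : ℕ →₀ ℕ
  coin : ℕ
  out : List ℕ
  time : ℕ
  peak : ℕ

/-- Account for an evaluation of cost `w`: it takes `w` units of time, and at most `w` bits of
working storage in addition to the memory. -/
def State.charge (s : State) (w : ℕ) : State :=
  { s with time := s.time + w, peak := max s.peak (memBits s.mem + w) }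

/-- Write `v` into the cell with address `a`. -/
noncomputable def State.write (s : State) (a v : ℕ) : State :=
  { s with mem := s.mem.update a v, peak := max s.peak (memBits (s.mem.update a v)) }

/-- Read the next coin of the tape `ω` into the cell with address `a`. The tape is read once, from
left to right: a coin that is needed again has to be kept in memory. -/
noncomputable def State.toss (ω : ℕ → Bool) (s : State) (a : ℕ) : State :=
  { s.write a (if ω s.coin then 1 else 0) with coin := s.coin + 1 }

/-- Append `v` to the output. -/
def State.print (s : State) (v : ℕ) : State := { s with out := s.out ++ [v] }

/-- `Exec ω p s t`: with coin tape `ω`, the program `p` started in `s` halts in `t`. -/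
inductive Exec (ω : ℕ → Bool) : Cmd → State → State → Prop
  | skip (s : State) : Exec ω .skip s s
  | assign (d e : Expr) (s : State) :
      Exec ω (.assign d e) s
        ((s.charge (d.cost s.mem + e.cost s.mem)).write (d.val s.mem) (e.val s.mem))
  | flip (d : Expr) (s : State) :
      Exec ω (.flip d) s ((s.charge (d.cost s.mem + 1)).toss ω (d.val s.mem))
  | emit (e : Expr) (s : State) :
      Exec ω (.emit e) s ((s.charge (e.cost s.mem)).print (e.val s.mem))
  | seq {p q : Cmd} {s t u : State} :
      Exec ω p s t → Exec ω q t u → Exec ω (.seq p q) s u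
  | ite_true {e : Expr} {p q : Cmd} {s t : State} :
      e.val s.mem ≠ 0 → Exec ω p (s.charge (e.cost s.mem)) t → Exec ω (.ite e p q) s t
  | ite_false {e : Expr} {p q : Cmd} {s t : State} :
      e.val s.mem = 0 → Exec ω q (s.charge (e.cost s.mem)) t → Exec ω (.ite e p q) s t
  | loop_true {e : Expr} {p : Cmd} {s t u : State} :
      e.val s.mem ≠ 0 → Exec ω p (s.charge (e.cost s.mem)) t → Exec ω (.loop e p) t u →
        Exec ω (.loop e p) s u
  | loop_false {e : Expr} {p : Cmd} {s : State} :
      e.val s.mem = 0 → Exec ω (.loop e p) s (s.charge (e.cost s.mem))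

/-- The law of a tape of independent fair coins. -/
noncomputable def coinMeasure : MeasureTheory.Measure (ℕ → Bool) :=
  MeasureTheory.Measure.infinitePi fun _ : ℕ => (PMF.uniformOfFintype Bool).toMeasure

/-! ### Dynamic graph streams -/

/-- An update on the vertex set `Fin n`: insertion (`ins = true`) or deletion (`ins = false`) of the
undirected edge with the distinct ends `u` and `v`, which are presented in either order. -/
structure EdgeUpdate (n : ℕ) where
  ins : Bool
  u : Fin n
  v : Fin n
  ne : u ≠ v

/-- The effect of an update on the current graph. -/
def EdgeUpdate.apply {n : ℕ} (G : SimpleGraph (Fin n)) (x : EdgeUpdate n) : SimpleGraph (Fin n) :=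
  if x.ins then G ⊔ SimpleGraph.edge x.u x.v else G \ SimpleGraph.edge x.u x.v

/-- The graph defined by a sequence of updates, starting from the graph without edges. -/
def graphAfter {n : ℕ} (S : List (EdgeUpdate n)) : SimpleGraph (Fin n) :=
  S.foldl EdgeUpdate.apply ⊥

/-- Only absent edges are inserted and only present edges are deleted. -/
def IsDynamicStream {n : ℕ} (S : List (EdgeUpdate n)) : Prop :=
  ∀ (i : ℕ) (hi : i < S.length),
    S[i].ins = true ↔ ¬ (graphAfter (S.take i)).Adj S[i].u S[i].v

/-- At every time, the current graph has a vertex cover with at most `k` vertices. -/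
def VertexCoverPromise {n : ℕ} (k : ℕ) (S : List (EdgeUpdate n)) : Prop :=
  ∀ i ≤ S.length, ∃ T : Finset (Fin n), T.card ≤ k ∧ (graphAfter (S.take i)).IsVertexCover T

/-! ### One-pass streaming algorithms -/

/-- A one-pass streaming algorithm: a program run once before the stream, a program run once for
each update, and a program run after the end of the stream. All three share the memory. -/
structure StreamAlgorithm where
  init : Cmd
  update : Cmd
  extract : Cmd

/-- The machine at the start: the cells `0`, `1`, `2` hold the three parameters, and all other
cells hold `0`. -/
noncomputable def startState (n k D : ℕ) : State where
  mem := ((Finsupp.single 0 n).update 1 k).update 2 D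
  coin := 0
  out := []
  time := 0
  peak := memBits (((Finsupp.single 0 n).update 1 k).update 2 D)

/-- The next update of the stream is placed in the cells `3`, `4`, `5`. -/
noncomputable def State.feed {n : ℕ} (s : State) (x : EdgeUpdate n) : State :=
  ((s.write 3 (if x.ins then 1 else 0)).write 4 x.u).write 5 x.v

/-- `p` processes the updates of the stream one after the other. -/
inductive Pass {n : ℕ} (ω : ℕ → Bool) (p : Cmd) : List (EdgeUpdate n) → State → State → Prop
  | nil (s : State) : Pass ω p [] s s
  | cons {x : EdgeUpdate n} {S : List (EdgeUpdate n)} {s t u : State} :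
      Exec ω p (s.feed x) t → Pass ω p S t u → Pass ω p (x :: S) s u

/-- With coin tape `ω` and parameters `n, k, D`, the algorithm `A` reaches the end of the stream `S`
in the state `s`, and from there its extraction halts in the state `t`. -/
def StreamAlgorithm.Run (A : StreamAlgorithm) (ω : ℕ → Bool) {n : ℕ} (k D : ℕ)
    (S : List (EdgeUpdate n)) (s t : State) : Prop :=
  ∃ r : State, Exec ω A.init (startState n k D) r ∧ Pass ω A.update S r s ∧ Exec ω A.extract s t

/-- The list `L` consists of at most `k` vertices, which form a vertex cover of `G`. -/
def IsSolution {n : ℕ} (k : ℕ) (G : SimpleGraph (Fin n)) (L : List ℕ) : Prop :=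
  L.length ≤ k ∧ (∀ a ∈ L, a < n) ∧ G.IsVertexCover {v : Fin n | (v : ℕ) ∈ L}

end StreamRAM

namespace StreamRAM

open Finset

/-! ### Cost of expressions and commands over memories with bounded cells -/

/-! No coins are needed: the algorithm is deterministic and succeeds on every tape, so the success
probability is one. With `k` capped at `n`, it keeps a list `H` of `k` vertices (digits in base `n`,
repetitions allowed) that covers the current graph, and charges every edge to the first vertex of
`H` that is an end of it. For each of the resulting stars it stores a linear sketch: the sums, over
the edges of the star, of the residues of the powers with exponents `0, …, 2k` of the edge code
modulo a prime `p > n ^ 2`. All sketches are packed into one number `S` of about `k ^ 2 * log n`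
bits. By linearity, inserting or deleting a covered edge is an addition or a subtraction.

Only an inserted edge without an end in `H` needs more work. A star with more than `k` edges is
heavy, and its centre lies in every cover with at most `k` vertices
(`Represents.mem_cover_of_heavy`), so it stays. A light star has at most `k` edges and is determined
by its sketch, by a Vandermonde argument (`multiset_eq_of_power_sums`). Hence the at most `k ^ 2`
light edges can be found by exhaustive search (`Represents.eq_lightEdges`). A second search extends
the heavy centres to a list covering the light edges and the new edge. It succeeds because the
promised cover contains the heavy centres (`Represents.exists_rebuild`). The heavy centres keep
their order at the front of the new list, so each heavy star keeps exactly its edges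
(`Represents.firstHit_heavy`) and its sketch is merely moved, without its edges being known
(`Represents.rebuild`).

The searches are long but reuse their memory, and time is bounded only for the extraction, which
prints `k` digits. The programs are verified in a big-step semantics `Ev` with total-correctness
rules `WP`, in which every stored number has to be below `2 ^ B`. Since only 36 cells are used,
`Ev.reaches` turns this into the space bound. -/

theorem Op.size_val_le (o : Op) (a b : ℕ) : (o.val a b).size ≤ a.size + b.size + 1 := by
  have ha := Nat.lt_size_self a
  have hb := Nat.lt_size_self b
  have h1 : 2 ^ a.size ≤ 2 ^ (a.size + b.size) := Nat.pow_le_pow_right (by norm_num) (by omega)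
  have h2 : 2 ^ b.size ≤ 2 ^ (a.size + b.size) := Nat.pow_le_pow_right (by norm_num) (by omega)
  have h3 : 2 ^ (a.size + b.size + 1) = 2 * 2 ^ (a.size + b.size) := by ring
  rw [Nat.size_le]
  have hle : ∀ x, x ≤ a → x < 2 ^ (a.size + b.size + 1) := fun x hx => by omega
  have hone : ∀ x, x ≤ 1 → x < 2 ^ (a.size + b.size + 1) := fun x hx => by
    have : 0 < 2 ^ (a.size + b.size) := by positivity
    omega
  cases o with
  | add => simp only [Op.val]; omega
  | sub => exact hle _ (Nat.sub_le _ _)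
  | mul =>
    simp only [Op.val]
    have : a * b < 2 ^ a.size * 2 ^ b.size := Nat.mul_lt_mul'' ha hb
    rw [← pow_add] at this
    omega
  | div => exact hle _ (Nat.div_le_self _ _)
  | mod => exact hle _ (Nat.mod_le _ _)
  | and => exact hle _ Nat.and_le_left
  | xor =>
    simp only [Op.val]
    exact Nat.xor_lt_two_pow (by omega) (by omega)
  | eq => exact hone _ (by simp only [Op.val]; split_ifs <;> simp)
  | lt => exact hone _ (by simp only [Op.val]; split_ifs <;> simp)

/-- A coefficient bounding the cost of an expression relative to the length of the cells. -/
def Expr.weight : Expr → ℕ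
  | lit v => 1 + v.size
  | mem a => 2 * a.weight + 2
  | op _ a b => 3 * (a.weight + b.weight) + 2

/-- The two bounds need a common induction, because the cost of an operation contains the lengths of
its operands. The factors 2 and 3 in `Expr.weight` pay for an operand's cost, its length and its
share of the length of the result. -/
theorem Expr.size_val_le_and_cost_le {B : ℕ} {M : ℕ →₀ ℕ} (hM : ∀ a, M a < 2 ^ B) (e : Expr) :
    (e.val M).size ≤ e.weight * (B + 1) ∧ e.cost M ≤ e.weight * (B + 1) := by
  induction e with
  | lit v =>
    simp only [val, cost, weight]
    constructor <;> nlinarith [Nat.zero_le (v.size * B)]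
  | mem a ih =>
    have h : (M (a.val M)).size ≤ B := Nat.size_le.2 (hM _)
    simp only [val, cost, weight]
    constructor <;> nlinarith [ih.1, ih.2, Nat.zero_le (a.weight * (B + 1))]
  | op o a b iha ihb =>
    have h := o.size_val_le (a.val M) (b.val M)
    simp only [val, cost, weight]
    constructor <;> nlinarith [iha.1, iha.2, ihb.1, ihb.2]

theorem Expr.cost_le {B : ℕ} {M : ℕ →₀ ℕ} (hM : ∀ a, M a < 2 ^ B) (e : Expr) :
    e.cost M ≤ e.weight * (B + 1) := (e.size_val_le_and_cost_le hM).2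

/-- A coefficient bounding the working storage of a command relative to the length of the cells. -/
def Cmd.weight : Cmd → ℕ
  | skip => 0
  | assign d e => d.weight + e.weight
  | flip d => d.weight + 1
  | emit e => e.weight
  | seq p q => max p.weight q.weight
  | ite e p q => max e.weight (max p.weight q.weight)
  | loop e p => max e.weight p.weight

/-- The command writes only to cells below `r`, given by literal addresses. -/
def Cmd.Within (r : ℕ) : Cmd → Prop
  | skip => True
  | assign d _ => ∃ a < r, d = .lit a
  | flip d => ∃ a < r, d = .lit a
  | emit _ => True
  | seq p q => p.Within r ∧ q.Within r
  | ite _ p q => p.Within r ∧ q.Within r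
  | loop _ p => p.Within r

/-- All cells hold fewer than `B + 1` bits, and only the first `r` cells are used. -/
def Bounded (r B : ℕ) (M : ℕ →₀ ℕ) : Prop := (∀ a, M a < 2 ^ B) ∧ ∀ a, r ≤ a → M a = 0

theorem Bounded.update {r B : ℕ} {M : ℕ →₀ ℕ} (h : Bounded r B M) {a v : ℕ} (ha : a < r)
    (hv : v < 2 ^ B) : Bounded r B (M.update a v) := by
  constructor
  · intro b
    rw [Finsupp.coe_update, Function.update_apply]
    split_ifs
    exacts [hv, h.1 b]
  · intro b hb
    rw [Finsupp.coe_update, Function.update_apply, if_neg (by omega)]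
    exact h.2 b hb

theorem Bounded.memBits_le {r B : ℕ} {M : ℕ →₀ ℕ} (h : Bounded r B M) :
    memBits M ≤ r * (r + B) := by
  have hs : M.support ⊆ Finset.range r := by
    intro a ha
    rw [Finset.mem_range]
    by_contra hc
    exact (Finsupp.mem_support_iff.1 ha) (h.2 a (by omega))
  calc memBits M = ∑ a ∈ M.support, (a.size + (M a).size) := rfl
    _ ≤ ∑ a ∈ Finset.range r, (a.size + (M a).size) := Finset.sum_le_sum_of_subset hs
    _ ≤ ∑ _a ∈ Finset.range r, (r + B) := by
      refine Finset.sum_le_sum fun a ha => ?_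
      have h1 : a.size ≤ a := Nat.size_le.2 Nat.lt_two_pow_self
      have h2 : (M a).size ≤ B := Nat.size_le.2 (h.1 a)
      have := Finset.mem_range.1 ha
      omega
    _ = r * (r + B) := by simp

/-! ### Big-step semantics on bounded memories -/

/-- `Ev B p M M'`: the command `p`, which uses neither coins nor output, turns the memory `M` into
`M'`, and stores only numbers below `2 ^ B`. -/
inductive Ev (B : ℕ) : Cmd → (ℕ →₀ ℕ) → (ℕ →₀ ℕ) → Prop
  | skip (M) : Ev B .skip M M
  | assign (a : ℕ) (e : Expr) (M : ℕ →₀ ℕ) : e.val M < 2 ^ B →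
      Ev B (.assign (.lit a) e) M (M.update a (e.val M))
  | seq {p q M M' M''} : Ev B p M M' → Ev B q M' M'' → Ev B (.seq p q) M M''
  | ite_true {e p q M M'} : e.val M ≠ 0 → Ev B p M M' → Ev B (.ite e p q) M M'
  | ite_false {e p q M M'} : e.val M = 0 → Ev B q M M' → Ev B (.ite e p q) M M'
  | loop_true {e p M M' M''} : e.val M ≠ 0 → Ev B p M M' → Ev B (.loop e p) M' M'' →
      Ev B (.loop e p) M M''
  | loop_false {e p M} : e.val M = 0 → Ev B (.loop e p) M M

/-- The number of bits used by a command of weight `w` on memories with `r` cells of `B` bits. -/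
def spaceBound (r B w : ℕ) : ℕ := r * (r + B) + w * (B + 1)

theorem spaceBound_mono {r B w w' : ℕ} (h : w ≤ w') : spaceBound r B w ≤ spaceBound r B w' := by
  unfold spaceBound
  gcongr

/-- An execution from `s` that computes the memory `M'` without output in bounded space. -/
def Reaches (ω : ℕ → Bool) (r B w : ℕ) (p : Cmd) (s : State) (M' : ℕ →₀ ℕ) : Prop :=
  ∃ t, Exec ω p s t ∧ t.mem = M' ∧ t.out = s.out ∧ Bounded r B M' ∧
    t.peak ≤ max s.peak (spaceBound r B w)

/-- The working storage of one test is already contained in the budget `spaceBound r B w`, so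
charging for it before running the command does not worsen the bound. -/
theorem Reaches.charge {ω : ℕ → Bool} {r B w c : ℕ} {p : Cmd} {s : State} {M' : ℕ →₀ ℕ}
    (h : Reaches ω r B w p (s.charge c) M') (hb : Bounded r B s.mem) (hc : c ≤ w * (B + 1)) :
    ∃ t, Exec ω p (s.charge c) t ∧ t.mem = M' ∧ t.out = s.out ∧ Bounded r B M' ∧
      t.peak ≤ max s.peak (spaceBound r B w) := by
  obtain ⟨t, h1, h2, h3, h4, h5⟩ := h
  refine ⟨t, h1, h2, h3, h4, h5.trans (max_le (max_le (le_max_left _ _) ?_) (le_max_right _ _))⟩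
  refine le_trans ?_ (le_max_right _ _)
  have := hb.memBits_le
  unfold spaceBound
  omega

/-- Peaks combine by maxima, and every intermediate memory is bounded, so the space does not depend
on the number of steps. This is what makes exhaustive search affordable. -/
theorem Ev.reaches {B : ℕ} {p : Cmd} {M M' : ℕ →₀ ℕ} (h : Ev B p M M') (ω : ℕ → Bool) {r w : ℕ}
    (hr : p.Within r) (hw : p.weight ≤ w) (hM : Bounded r B M) :
    ∀ s : State, s.mem = M → Reaches ω r B w p s M' := by
  induction h with
  | skip M =>
    rintro s rfl
    exact ⟨s, .skip s, rfl, rfl, hM, le_max_left _ _⟩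
  | assign a e M he =>
    rintro s rfl
    obtain ⟨a', ha', h'⟩ := hr
    cases h'
    have hb' := hM.update ha' he
    refine ⟨_, .assign _ _ s, rfl, rfl, hb', ?_⟩
    have h1 := (Expr.lit a).cost_le hM.1
    have h2 := e.cost_le hM.1
    have h3 := hM.memBits_le
    have h4 := hb'.memBits_le
    have h5 : ((Expr.lit a).weight + e.weight) * (B + 1) ≤ w * (B + 1) :=
      Nat.mul_le_mul_right _ hw
    simp only [State.write, State.charge, spaceBound, Expr.val] at *
    refine max_le (max_le (le_max_left _ _) (le_trans ?_ (le_max_right _ _)))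
      (le_trans ?_ (le_max_right _ _))
    · nlinarith
    · nlinarith
  | seq _ _ ih1 ih2 =>
    rintro s hs
    have hw' := max_le_iff.1 hw
    obtain ⟨t, h1, h2, h3, h4, h5⟩ := ih1 hr.1 hw'.1 hM s hs
    obtain ⟨u, g1, g2, g3, g4, g5⟩ := ih2 hr.2 hw'.2 h4 t h2
    exact ⟨u, .seq h1 g1, g2, g3.trans h3, g4,
      g5.trans (max_le h5 (le_max_right _ _))⟩
  | @ite_true e p q M M' he _ ih =>
    rintro s rfl
    have hw' := max_le_iff.1 hw
    obtain ⟨t, h1, h⟩ := (ih hr.1 (max_le_iff.1 hw'.2).1 hM (s.charge (e.cost s.mem)) rfl).charge hM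
      ((e.cost_le hM.1).trans (Nat.mul_le_mul_right _ hw'.1))
    exact ⟨t, .ite_true he h1, h⟩
  | @ite_false e p q M M' he _ ih =>
    rintro s rfl
    have hw' := max_le_iff.1 hw
    obtain ⟨t, h1, h⟩ := (ih hr.2 (max_le_iff.1 hw'.2).2 hM (s.charge (e.cost s.mem)) rfl).charge hM
      ((e.cost_le hM.1).trans (Nat.mul_le_mul_right _ hw'.1))
    exact ⟨t, .ite_false he h1, h⟩
  | @loop_true e p M M' M'' he _ _ ih1 ih2 =>
    rintro s rfl
    have hw' := max_le_iff.1 hw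
    obtain ⟨t, h1, h2, h3, h4, h5⟩ := (ih1 hr hw'.2 hM (s.charge (e.cost s.mem)) rfl).charge hM
      ((e.cost_le hM.1).trans (Nat.mul_le_mul_right _ hw'.1))
    obtain ⟨u, g1, g2, g3, g4, g5⟩ := ih2 hr hw h4 t h2
    exact ⟨u, .loop_true he h1 g1, g2, g3.trans h3, g4,
      g5.trans (max_le h5 (le_max_right _ _))⟩
  | @loop_false e p M he =>
    rintro s rfl
    have hw' := max_le_iff.1 hw
    refine ⟨_, .loop_false he, rfl, rfl, hM, max_le (le_max_left _ _) (le_trans ?_ (le_max_right _ _))⟩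
    have := (e.cost_le hM.1).trans (Nat.mul_le_mul_right _ hw'.1)
    have := hM.memBits_le
    unfold spaceBound
    omega

/-! ### Total correctness -/

/-- The cell `a` is not written by the command. -/
def Cmd.keeps (a : ℕ) : Cmd → Bool
  | skip => true
  | assign (.lit b) _ => a != b
  | assign _ _ => false
  | flip _ => false
  | emit _ => true
  | seq p q => p.keeps a && q.keeps a
  | ite _ p q => p.keeps a && q.keeps a
  | loop _ p => p.keeps a

/-- Since `Cmd.keeps` is a syntactic Boolean test, the frame conditions of concrete programs are
settled by `decide`. -/
theorem Ev.frame {B : ℕ} {p : Cmd} {M M' : ℕ →₀ ℕ} (h : Ev B p M M') {a : ℕ}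
    (ha : p.keeps a = true) : M' a = M a := by
  induction h with
  | skip M => rfl
  | assign b e M he =>
    rw [Finsupp.coe_update, Function.update_of_ne]
    simpa [Cmd.keeps] using ha
  | seq _ _ ih1 ih2 =>
    simp only [Cmd.keeps, Bool.and_eq_true] at ha
    rw [ih2 ha.2, ih1 ha.1]
  | ite_true _ _ ih =>
    simp only [Cmd.keeps, Bool.and_eq_true] at ha
    exact ih ha.1
  | ite_false _ _ ih =>
    simp only [Cmd.keeps, Bool.and_eq_true] at ha
    exact ih ha.2
  | loop_true _ _ _ ih1 ih2 => rw [ih2 ha, ih1 ha]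
  | loop_false _ => rfl

/-- Started in the memory `M`, the command halts in a memory with the property `Q`, and it stores
only numbers below `2 ^ B`. -/
def WP (B : ℕ) (p : Cmd) (Q : (ℕ →₀ ℕ) → Prop) (M : ℕ →₀ ℕ) : Prop := ∃ M', Ev B p M M' ∧ Q M'

namespace WP

variable {B : ℕ} {p q : Cmd} {e : Expr} {P Q : (ℕ →₀ ℕ) → Prop} {M : ℕ →₀ ℕ}

theorem assign {a : ℕ} (h : e.val M < 2 ^ B) (hQ : Q (M.update a (e.val M))) :
    WP B (.assign (.lit a) e) Q M := ⟨_, .assign a e M h, hQ⟩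

theorem seq (h : WP B p (WP B q Q) M) : WP B (.seq p q) Q M := by
  obtain ⟨M', h1, M'', h2, h3⟩ := h
  exact ⟨M'', .seq h1 h2, h3⟩

theorem ite (h1 : e.val M ≠ 0 → WP B p Q M) (h2 : e.val M = 0 → WP B q Q M) :
    WP B (.ite e p q) Q M := by
  by_cases h : e.val M = 0
  · obtain ⟨M', h3, h4⟩ := h2 h
    exact ⟨M', .ite_false h h3, h4⟩
  · obtain ⟨M', h3, h4⟩ := h1 h
    exact ⟨M', .ite_true h h3, h4⟩

theorem skip (h : Q M) : WP B .skip Q M := ⟨M, .skip M, h⟩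

/-- The rule of consequence, with the cells that the command does not write. -/
theorem imp (h : WP B p P M)
    (hi : ∀ M', (∀ a, p.keeps a = true → M' a = M a) → P M' → Q M') : WP B p Q M := by
  obtain ⟨M', h1, h2⟩ := h
  exact ⟨M', h1, hi M' (fun a ha => h1.frame ha) h2⟩

/-- The rule for loops with invariant `P` and variant `μ`. -/
theorem loop (μ : (ℕ →₀ ℕ) → ℕ) (h0 : P M)
    (hs : ∀ M', (∀ a, p.keeps a = true → M' a = M a) → P M' → e.val M' ≠ 0 →
      WP B p (fun M'' => P M'' ∧ μ M'' < μ M') M')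
    (he : ∀ M', (∀ a, p.keeps a = true → M' a = M a) → P M' → e.val M' = 0 → Q M') :
    WP B (.loop e p) Q M := by
  -- Strong induction on a bound for the variant. The frame always refers to the memory before the
  -- whole loop.
  have key : ∀ m, ∀ M', μ M' ≤ m → (∀ a, p.keeps a = true → M' a = M a) → P M' →
      WP B (.loop e p) Q M' := by
    intro m
    induction m using Nat.strong_induction_on with
    | _ m ih =>
      intro M' hm hf hP
      by_cases hz : e.val M' = 0
      · exact ⟨M', .loop_false hz, he M' hf hP hz⟩
      · obtain ⟨M'', h1, h2, h3⟩ := hs M' hf hP hz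
        obtain ⟨M₃, h4, h5⟩ := ih (μ M'') (by omega) M'' le_rfl
          (fun a ha => (h1.frame ha).trans (hf a ha)) h2
        exact ⟨M₃, .loop_true hz h1 h4, h5⟩
  exact key _ M le_rfl (fun _ _ => rfl) h0

end WP

/-! ### Positional expansions -/

theorem sum_mul_pow_lt {q R : ℕ} {a : ℕ → ℕ} (ha : ∀ r < R, a r < q) :
    ∑ r ∈ range R, a r * q ^ r < q ^ R := by
  induction R with
  | zero => simp
  | succ R ih =>
    rw [sum_range_succ, pow_succ]
    have h1 := ih fun r hr => ha r (by omega)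
    have h2 := ha R (by omega)
    have h3 : (a R + 1) * q ^ R ≤ q * q ^ R := Nat.mul_le_mul_right _ h2
    nlinarith

/-- Digits below the base produce no carries, so they can be read off whatever `X` sits above them.
-/
theorem sum_mul_pow_add_div_mod {q R : ℕ} {a : ℕ → ℕ} (X : ℕ) {i : ℕ} (hi : i < R)
    (ha : ∀ r < R, a r < q) :
    (∑ r ∈ range R, a r * q ^ r + X * q ^ R) / q ^ i % q = a i := by
  induction R generalizing a i with
  | zero => omega
  | succ R ih =>
    have hq : 0 < q := lt_of_le_of_lt (Nat.zero_le _) (ha i hi)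
    have h0 : ∑ r ∈ range (R + 1), a r * q ^ r + X * q ^ (R + 1) =
        a 0 + q * (∑ r ∈ range R, a (r + 1) * q ^ r + X * q ^ R) := by
      rw [sum_range_succ', mul_add, mul_sum]
      have : ∀ r, a (r + 1) * q ^ (r + 1) = q * (a (r + 1) * q ^ r) := fun r => by ring
      simp only [this]
      ring
    rw [h0]
    cases i with
    | zero => rw [pow_zero, Nat.div_one, Nat.add_mul_mod_self_left, Nat.mod_eq_of_lt (ha 0 hi)]
    | succ i =>
      rw [pow_succ', ← Nat.div_div_eq_div_mul, Nat.add_mul_div_left _ _ hq,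
        Nat.div_eq_of_lt (ha 0 (by omega)), zero_add]
      exact ih (by omega) fun r hr => ha (r + 1) (by omega)

theorem sum_mul_pow_div_mod {q R : ℕ} {a : ℕ → ℕ} {i : ℕ} (hi : i < R) (ha : ∀ r < R, a r < q) :
    (∑ r ∈ range R, a r * q ^ r) / q ^ i % q = a i := by
  simpa using sum_mul_pow_add_div_mod 0 hi ha

theorem sum_mul_pow_inj {q R : ℕ} {a b : ℕ → ℕ} (ha : ∀ r < R, a r < q) (hb : ∀ r < R, b r < q)
    (h : ∑ r ∈ range R, a r * q ^ r = ∑ r ∈ range R, b r * q ^ r) {i : ℕ} (hi : i < R) :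
    a i = b i := by
  rw [← sum_mul_pow_div_mod hi ha, h, sum_mul_pow_div_mod hi hb]

/-- Numbering the indices with `P` by their rank `Nat.count P i`, with inverse `Nat.nth P`, turns a
selective sum into a positional expansion with consecutive exponents. -/
theorem sum_ite_count {α : Type*} [AddCommMonoid α] (P : ℕ → Prop) [DecidablePred P]
    (F : ℕ → ℕ → α) (j : ℕ) :
    ∑ i ∈ range j, (if P i then F i (Nat.count P i) else 0) =
      ∑ r ∈ range (Nat.count P j), F (Nat.nth P r) r := by
  induction j with
  | zero => simp
  | succ j ih =>
    rw [sum_range_succ, ih, Nat.count_succ]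
    split_ifs with h
    · rw [sum_range_succ, Nat.nth_count h]
    · simp

theorem exists_digits_of_finset {b : ℕ} (T : Finset ℕ) (hT : ∀ t ∈ T, t < b) :
    ∃ X < b ^ #T, ∀ t ∈ T, ∃ j < #T, X / b ^ j % b = t := by
  induction T using Finset.induction_on with
  | empty => exact ⟨0, by simp, by simp⟩
  | insert a T ha ih =>
    obtain ⟨X, hX, h⟩ := ih fun t ht => hT t (mem_insert_of_mem ht)
    have hab := hT a (mem_insert_self _ _)
    have hb : 0 < b := by omega
    refine ⟨a + b * X, ?_, ?_⟩
    · rw [card_insert_of_notMem ha, pow_succ]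
      nlinarith
    · intro t ht
      rw [card_insert_of_notMem ha]
      rcases mem_insert.1 ht with rfl | ht
      · exact ⟨0, by omega, by simp [Nat.mod_eq_of_lt hab]⟩
      · obtain ⟨j, hj, h'⟩ := h t ht
        refine ⟨j + 1, by omega, ?_⟩
        rw [pow_succ', ← Nat.div_div_eq_div_mul, Nat.add_mul_div_left _ _ hb,
          Nat.div_eq_of_lt hab, zero_add, h']

/-! ### Recovery of small multisets from power sums -/

/-- The Vandermonde matrix of distinct nodes is invertible. -/
theorem eq_zero_of_power_sums {F : Type*} [Field F] {A : Finset F} {c : F → F}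
    (h : ∀ r < #A, ∑ a ∈ A, c a * a ^ r = 0) : ∀ a ∈ A, c a = 0 := by
  let f : Fin #A → F := fun i => (A.equivFin.symm i : F)
  have hf : Function.Injective f := fun i j hij => A.equivFin.symm.injective (Subtype.ext hij)
  have h0 := Matrix.eq_zero_of_forall_pow_sum_mul_pow_eq_zero (v := fun i => c (f i)) hf (by
    intro r
    rw [← h r r.2, ← sum_coe_sort A fun a => c a * a ^ (r : ℕ)]
    exact Fintype.sum_equiv A.equivFin.symm _ _ fun i => rfl)
  intro a ha
  have := congrFun h0 (A.equivFin ⟨a, ha⟩)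
  simpa [f] using this

/-- The difference of the two multiplicity functions lives on at most `2 * k` points, and its first
`2 * k` power sums vanish in `ZMod p`; so it vanishes modulo `p`. Elements below `p` stay distinct
modulo `p`, and multiplicities are at most `k < p`, so nothing is lost by reduction. -/
theorem multiset_eq_of_power_sums {p k : ℕ} (hp : p.Prime) (hk : k < p) {m₁ m₂ : Multiset ℕ}
    (hm₁ : ∀ a ∈ m₁, a < p) (hm₂ : ∀ a ∈ m₂, a < p) (hc₁ : m₁.card ≤ k) (hc₂ : m₂.card ≤ k)
    (h : ∀ r < 2 * k, (m₁.map fun e => e ^ r % p).sum = (m₂.map fun e => e ^ r % p).sum) :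
    m₁ = m₂ := by
  have : Fact p.Prime := ⟨hp⟩
  set A : Finset ℕ := m₁.toFinset ∪ m₂.toFinset with hA
  have hAp : ∀ a ∈ A, a < p := by
    intro a ha
    rcases mem_union.1 ha with ha | ha
    · exact hm₁ a (Multiset.mem_toFinset.1 ha)
    · exact hm₂ a (Multiset.mem_toFinset.1 ha)
  have hcard : #A ≤ 2 * k := by
    have h1 := card_union_le m₁.toFinset m₂.toFinset
    have h2 := Multiset.toFinset_card_le m₁
    have h3 := Multiset.toFinset_card_le m₂
    rw [← hA] at h1
    omega
  have hinj : Set.InjOn (fun a : ℕ => (a : ZMod p)) A := by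
    intro a ha b hb hab
    have := (ZMod.natCast_eq_natCast_iff' a b p).1 hab
    rwa [Nat.mod_eq_of_lt (hAp a ha), Nat.mod_eq_of_lt (hAp b hb)] at this
  have hsum : ∀ (m : Multiset ℕ), m.toFinset ⊆ A → ∀ r,
      (((m.map fun e => e ^ r % p).sum : ℕ) : ZMod p) =
        ∑ a ∈ A, (m.count a : ZMod p) * (a : ZMod p) ^ r := by
    intro m hm r
    rw [Finset.sum_multiset_map_count]
    push_cast
    rw [← Finset.sum_subset hm]
    · refine sum_congr rfl fun a _ => ?_
      simp
    · intro a _ ha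
      rw [Multiset.mem_toFinset] at ha
      simp [Multiset.count_eq_zero.2 ha]
  let c : ZMod p → ZMod p := fun z => (m₁.count z.val : ZMod p) - (m₂.count z.val : ZMod p)
  have hzero : ∀ a ∈ A.image (fun a : ℕ => (a : ZMod p)), c a = 0 := by
    apply eq_zero_of_power_sums
    intro r hr
    rw [card_image_of_injOn hinj] at hr
    rw [sum_image hinj]
    have h1 := hsum m₁ subset_union_left r
    have h2 := hsum m₂ subset_union_right r
    rw [h r (by omega), h2] at h1
    have : ∀ a ∈ A, c (a : ZMod p) * (a : ZMod p) ^ r =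
        (m₁.count a : ZMod p) * (a : ZMod p) ^ r - (m₂.count a : ZMod p) * (a : ZMod p) ^ r := by
      intro a ha
      simp only [c]
      rw [ZMod.val_natCast_of_lt (hAp a ha)]
      ring
    rw [sum_congr rfl this, sum_sub_distrib, h1, sub_self]
  ext a
  by_cases ha : a ∈ A
  · have h0 := hzero _ (mem_image_of_mem _ ha)
    simp only [c] at h0
    rw [ZMod.val_natCast_of_lt (hAp a ha), sub_eq_zero, ZMod.natCast_eq_natCast_iff'] at h0
    have h1 := Multiset.count_le_card a m₁
    have h2 := Multiset.count_le_card a m₂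
    rwa [Nat.mod_eq_of_lt (by omega), Nat.mod_eq_of_lt (by omega)] at h0
  · simp only [hA, mem_union, Multiset.mem_toFinset, not_or] at ha
    rw [Multiset.count_eq_zero.2 ha.1, Multiset.count_eq_zero.2 ha.2]

/-! ### The sketch of a set of edges

An edge with ends `u < v` of a graph on `n` vertices is coded by the number `u * n + v`. -/

/-- The residues modulo `p` of the first `R` powers of `e`, packed in base `p * p`. -/
def sketch (p R e : ℕ) : ℕ := ∑ r ∈ range R, e ^ r % p * (p * p) ^ r

/-- The sum of the sketches of the elements of `m`. -/
def sketchSum (p R : ℕ) (m : Multiset ℕ) : ℕ := (m.map (sketch p R)).sum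

theorem sketchSum_eq (p R : ℕ) (m : Multiset ℕ) :
    sketchSum p R m = ∑ r ∈ range R, (m.map fun e => e ^ r % p).sum * (p * p) ^ r := by
  unfold sketchSum
  induction m using Multiset.induction_on with
  | empty => simp
  | cons a m ih =>
    simp only [Multiset.map_cons, Multiset.sum_cons, ih, add_mul, sum_add_distrib]
    rfl

/-- This is why the base is `p * p`: at most `p` residues, each at most `p - 1`, cannot cause a
carry. -/
theorem row_lt {p r : ℕ} (hp : 0 < p) {m : Multiset ℕ} (hm : m.card ≤ p) :
    (m.map fun e => e ^ r % p).sum < p * p := by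
  have h := Multiset.sum_le_card_nsmul (m.map fun e => e ^ r % p) (p - 1) (by
    intro x hx
    obtain ⟨e, _, rfl⟩ := Multiset.mem_map.1 hx
    have := Nat.mod_lt (e ^ r) hp
    omega)
  rw [Multiset.card_map, smul_eq_mul] at h
  calc _ ≤ m.card * (p - 1) := h
    _ ≤ p * (p - 1) := Nat.mul_le_mul_right _ hm
    _ < p * p := Nat.mul_lt_mul_of_pos_left (by omega) hp

theorem sketchSum_lt {p R : ℕ} (hp : 0 < p) {m : Multiset ℕ} (hm : m.card ≤ p) :
    sketchSum p R m < (p * p) ^ R := by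
  rw [sketchSum_eq]
  exact sum_mul_pow_lt fun r _ => row_lt hp hm

/-- Zeroth powers are `1`, so the lowest digit of a sketch counts the edges. With `2 * k + 1` rows
this digit exists even for `k = 0`. -/
theorem sketchSum_mod {p R : ℕ} (hp : 1 < p) (hR : 0 < R) {m : Multiset ℕ} (hm : m.card ≤ p) :
    sketchSum p R m % (p * p) = m.card := by
  have h := sum_mul_pow_div_mod (a := fun r => (m.map fun e => e ^ r % p).sum) hR
    fun r _ => row_lt (by omega) hm
  rw [← sketchSum_eq, pow_zero, Nat.div_one] at h
  rw [h]
  simp [Nat.mod_eq_of_lt hp]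

/-- Only `m₁` is known to be small. The counting digit forces `m₂` to have the same cardinality,
after which the power sums decide. -/
theorem multiset_eq_of_sketchSum_eq {p k : ℕ} (hp : p.Prime) (hk : k < p) {m₁ m₂ : Multiset ℕ}
    (hm₁ : ∀ a ∈ m₁, a < p) (hm₂ : ∀ a ∈ m₂, a < p) (hc₁ : m₁.card ≤ k) (hc₂ : m₂.card ≤ p)
    (h : sketchSum p (2 * k + 1) m₁ = sketchSum p (2 * k + 1) m₂) : m₁ = m₂ := by
  have hc : m₂.card ≤ k := by
    rw [← sketchSum_mod hp.one_lt (by omega : 0 < 2 * k + 1) hc₂, ← h,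
      sketchSum_mod hp.one_lt (by omega) (by omega)]
    exact hc₁
  refine multiset_eq_of_power_sums hp hk hm₁ hm₂ hc₁ hc fun r hr => ?_
  rw [sketchSum_eq, sketchSum_eq] at h
  exact sum_mul_pow_inj (a := fun r => (m₁.map fun e => e ^ r % p).sum)
    (b := fun r => (m₂.map fun e => e ^ r % p).sum)
    (fun r _ => row_lt hp.pos (by omega)) (fun r _ => row_lt hp.pos hc₂) h (by omega)

/-- The counting digit of a single edge is `1`. Hence an uncovered edge always leaves a trace in a
packed sum. -/
theorem one_le_sketch {p R : ℕ} (hp : 1 < p) (hR : 0 < R) (e : ℕ) : 1 ≤ sketch p R e := by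
  have := sketchSum_mod hp hR (m := {e}) (by simp; omega)
  simp only [sketchSum, Multiset.map_singleton, Multiset.sum_singleton,
    Multiset.card_singleton] at this
  by_contra h
  have h0 : sketch p R e = 0 := by omega
  simp [h0] at this

/-! ### The first vertex of a list that is an end of an edge -/

/-- The first index below `k` of a digit of `U` in base `n` that is an end of `e`, or `k`. -/
def firstHit (n e : ℕ) : ℕ → ℕ → ℕ
  | 0, _ => 0
  | k + 1, U => if U % n = e / n ∨ U % n = e % n then 0 else firstHit n e k (U / n) + 1

/-- The digit of `U` with index `i` in base `n` is an end of `e`. -/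
def Hit (n e U i : ℕ) : Prop := U / n ^ i % n = e / n ∨ U / n ^ i % n = e % n

theorem hit_succ {n e U i : ℕ} : Hit n e U (i + 1) ↔ Hit n e (U / n) i := by
  rw [Hit, Hit, pow_succ', ← Nat.div_div_eq_div_mul]

theorem firstHit_le (n e k U : ℕ) : firstHit n e k U ≤ k := by
  induction k generalizing U with
  | zero => simp [firstHit]
  | succ k ih =>
    rw [firstHit]
    split_ifs
    · omega
    · have := ih (U / n)
      omega

theorem hit_firstHit {n e k U : ℕ} (h : firstHit n e k U < k) : Hit n e U (firstHit n e k U) := by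
  induction k generalizing U with
  | zero => omega
  | succ k ih =>
    rw [firstHit] at h ⊢
    split_ifs at h ⊢ with h0
    · simpa [Hit] using h0
    · rw [hit_succ]
      exact ih (by omega)

theorem not_hit_of_lt_firstHit {n e k U i : ℕ} (h : i < firstHit n e k U) : ¬ Hit n e U i := by
  induction k generalizing U i with
  | zero => simp [firstHit] at h
  | succ k ih =>
    rw [firstHit] at h
    split_ifs at h with h0
    · omega
    · cases i with
      | zero => simpa [Hit] using h0
      | succ i =>
        rw [hit_succ]
        exact ih (by omega)

theorem firstHit_lt_of_hit {n e k U i : ℕ} (hi : i < k) (h : Hit n e U i) :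
    firstHit n e k U < k := by
  by_contra hc
  exact not_hit_of_lt_firstHit (by omega : i < firstHit n e k U) h

theorem firstHit_eq {n e k U i : ℕ} (hi : i < k) (h : Hit n e U i)
    (h' : ∀ j < i, ¬ Hit n e U j) : firstHit n e k U = i := by
  rcases lt_trichotomy (firstHit n e k U) i with hlt | heq | hgt
  · exact absurd (hit_firstHit (hlt.trans hi)) (h' _ hlt)
  · exact heq
  · exact absurd h (not_hit_of_lt_firstHit hgt)

/-! ### Sketches sorted by the vertices of a list -/

/-- The base in which the sketches of the vertices are packed. -/
def sketchBase (p k : ℕ) : ℕ := (p * p) ^ (2 * k + 1)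

/-- The sketch of the edge `e`, placed at the first vertex of the list `H` that is an end of `e`. -/
def load (n k p H e : ℕ) : ℕ := sketch p (2 * k + 1) e * sketchBase p k ^ firstHit n e k H

/-- The sum of the loads of the elements of `m`. -/
def loadSum (n k p H : ℕ) (m : Multiset ℕ) : ℕ := (m.map (load n k p H)).sum

theorem loadSum_add (n k p H : ℕ) (m₁ m₂ : Multiset ℕ) :
    loadSum n k p H (m₁ + m₂) = loadSum n k p H m₁ + loadSum n k p H m₂ := by
  simp [loadSum]

/-- Grouping the edges by stars exhibits the sum as an expansion in base `sketchBase p k`; the digit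
with index `k` collects the uncovered edges. -/
theorem loadSum_eq (n k p H : ℕ) (m : Multiset ℕ) :
    loadSum n k p H m = ∑ i ∈ range (k + 1),
      sketchSum p (2 * k + 1) (m.filter fun e => firstHit n e k H = i) * sketchBase p k ^ i := by
  induction m using Multiset.induction_on with
  | empty => simp [loadSum, sketchSum]
  | cons a m ih =>
    have h : ∀ i, sketchSum p (2 * k + 1) ((a ::ₘ m).filter fun e => firstHit n e k H = i) *
        sketchBase p k ^ i =
        (if firstHit n a k H = i then sketch p (2 * k + 1) a * sketchBase p k ^ i else 0) +
        sketchSum p (2 * k + 1) (m.filter fun e => firstHit n e k H = i) * sketchBase p k ^ i := by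
      intro i
      rw [Multiset.filter_cons]
      split_ifs <;> simp [sketchSum, add_mul]
    simp only [h, sum_add_distrib, ← ih]
    rw [sum_ite_eq, if_pos (mem_range.2 (Nat.lt_succ_of_le (firstHit_le _ _ _ _)))]
    simp [loadSum, load]

theorem sketchBase_pos {p : ℕ} (hp : 0 < p) (k : ℕ) : 0 < sketchBase p k := by
  unfold sketchBase
  positivity

theorem card_filter_le' {m : Multiset ℕ} {q : ℕ} (hm : m.card ≤ q) (P : ℕ → Prop)
    [DecidablePred P] : (m.filter P).card ≤ q :=
  (Multiset.card_le_card (Multiset.filter_le _ _)).trans hm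

theorem loadSum_lt_of_forall {n k p H : ℕ} (hp : 0 < p) {m : Multiset ℕ} (hm : m.card ≤ p)
    (h : ∀ e ∈ m, firstHit n e k H < k) : loadSum n k p H m < sketchBase p k ^ k := by
  rw [loadSum_eq, sum_range_succ, Multiset.filter_eq_nil.2 fun e he => (h e he).ne]
  simp only [sketchSum, Multiset.map_zero, Multiset.sum_zero, zero_mul, add_zero]
  exact sum_mul_pow_lt fun r _ => sketchSum_lt hp (card_filter_le' hm _)

/-- An uncovered edge contributes a positive multiple of `sketchBase p k ^ k`. Together with
`loadSum_lt_of_forall`, a single comparison with this power tests whether a list covers a set of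
edges. -/
theorem forall_of_loadSum_lt {n k p H : ℕ} (hp : 1 < p) {m : Multiset ℕ}
    (h : loadSum n k p H m < sketchBase p k ^ k) : ∀ e ∈ m, firstHit n e k H < k := by
  intro e he
  by_contra hc
  have hk : firstHit n e k H = k := le_antisymm (firstHit_le _ _ _ _) (by omega)
  have h1 : load n k p H e ≤ loadSum n k p H m :=
    Multiset.single_le_sum (fun _ _ => Nat.zero_le _) _ (Multiset.mem_map_of_mem _ he)
  have h2 := one_le_sketch hp (by omega : 0 < 2 * k + 1) e
  rw [load, hk] at h1
  nlinarith [Nat.zero_le (sketchBase p k ^ k)]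

theorem loadSum_le {n k p H : ℕ} (hp : 1 < p) (m : Multiset ℕ) :
    loadSum n k p H m ≤ m.card * sketchBase p k ^ (k + 1) := by
  have h := Multiset.sum_le_card_nsmul (m.map (load n k p H)) (sketchBase p k ^ (k + 1)) (by
    intro x hx
    obtain ⟨e, _, rfl⟩ := Multiset.mem_map.1 hx
    have h1 : sketch p (2 * k + 1) e < sketchBase p k := by
      simpa [sketchSum, sketchBase] using
        sketchSum_lt (R := 2 * k + 1) (by omega : 0 < p) (m := {e}) (by simp; omega)
    rw [load, pow_succ']
    exact Nat.mul_le_mul h1.le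
      (Nat.pow_le_pow_right (sketchBase_pos (by omega) k) (firstHit_le _ _ _ _)))
  rwa [Multiset.card_map, smul_eq_mul] at h

/-- The digits agree star by star, so each small star is recovered separately. No smallness of the
stars of the competitor `m₂` is assumed, which allows a blind search among candidates. -/
theorem multiset_eq_of_loadSum_eq {n k p H : ℕ} (hp : p.Prime) (hk : k < p) {m₁ m₂ : Multiset ℕ}
    (hm₁ : ∀ a ∈ m₁, a < p) (hm₂ : ∀ a ∈ m₂, a < p) (hc₁ : m₁.card ≤ p) (hc₂ : m₂.card ≤ p)
    (hs : ∀ i, (m₁.filter fun e => firstHit n e k H = i).card ≤ k)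
    (h : loadSum n k p H m₁ = loadSum n k p H m₂) : m₁ = m₂ := by
  have key : ∀ i < k + 1, (m₁.filter fun e => firstHit n e k H = i) =
      m₂.filter fun e => firstHit n e k H = i := by
    intro i hi
    refine multiset_eq_of_sketchSum_eq hp hk (fun a ha => hm₁ a (Multiset.mem_filter.1 ha).1)
      (fun a ha => hm₂ a (Multiset.mem_filter.1 ha).1) (hs i) (card_filter_le' hc₂ _) ?_
    rw [loadSum_eq, loadSum_eq] at h
    exact sum_mul_pow_inj
      (a := fun i => sketchSum p (2 * k + 1) (m₁.filter fun e => firstHit n e k H = i))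
      (b := fun i => sketchSum p (2 * k + 1) (m₂.filter fun e => firstHit n e k H = i))
      (fun r _ => sketchSum_lt hp.pos (card_filter_le' hc₁ _))
      (fun r _ => sketchSum_lt hp.pos (card_filter_le' hc₂ _)) h hi
  ext a
  have h1 := congrArg (Multiset.count a)
    (key (firstHit n a k H) (Nat.lt_succ_of_le (firstHit_le _ _ _ _)))
  rwa [Multiset.count_filter, Multiset.count_filter, if_pos rfl, if_pos rfl] at h1

/-! ### Rebuilding the list of vertices -/

/-- The list `H` covers all edges of `E`, and `S` is the packed list of their sketches. -/
structure Represents (n k p : ℕ) (E : Finset ℕ) (H S : ℕ) : Prop where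
  eq_loadSum : S = loadSum n k p H E.val
  firstHit_lt : ∀ e ∈ E, firstHit n e k H < k

/-- The sketch with index `i`. -/
def slot (p k S i : ℕ) : ℕ := S / sketchBase p k ^ i % sketchBase p k

/-- The star of the vertex with index `i` has more than `k` edges. -/
def Heavy (p k S i : ℕ) : Prop := k < slot p k S i % (p * p)

instance (p k S : ℕ) : DecidablePred (Heavy p k S) := fun _ => Nat.decLt _ _

/-- The list of the vertices with a heavy star. -/
def heavyVertices (n k p H S : ℕ) : ℕ :=
  ∑ i ∈ range k, if Heavy p k S i then H / n ^ i % n * n ^ Nat.count (Heavy p k S) i else 0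

/-- The list of the sketches of the heavy stars. -/
def heavySlots (k p S : ℕ) : ℕ :=
  ∑ i ∈ range k,
    if Heavy p k S i then slot p k S i * sketchBase p k ^ Nat.count (Heavy p k S) i else 0

/-- The sketches of the stars that are not heavy, at their places. -/
def lightSlots (k p S : ℕ) : ℕ :=
  ∑ i ∈ range k, if Heavy p k S i then 0 else slot p k S i * sketchBase p k ^ i

/-- The number of heavy stars. -/
def heavyCount (k p S : ℕ) : ℕ := Nat.count (Heavy p k S) k

theorem heavyCount_le (k p S : ℕ) : heavyCount k p S ≤ k := Nat.count_le _

theorem heavyVertices_eq (n k p H S : ℕ) :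
    heavyVertices n k p H S = ∑ r ∈ range (heavyCount k p S),
      (H / n ^ Nat.nth (Heavy p k S) r % n) * n ^ r :=
  sum_ite_count (Heavy p k S) (fun i r => H / n ^ i % n * n ^ r) k

theorem heavyVertices_lt {n : ℕ} (hn : 0 < n) (k p H S : ℕ) :
    heavyVertices n k p H S < n ^ heavyCount k p S := by
  rw [heavyVertices_eq]
  exact sum_mul_pow_lt fun r _ => Nat.mod_lt _ hn

/-- The edges with a light star. -/
def lightEdges (n k p : ℕ) (E : Finset ℕ) (H S : ℕ) : Finset ℕ :=
  E.filter fun e => ¬ Heavy p k S (firstHit n e k H)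

/-- The edges with a heavy star. -/
def heavyEdges (n k p : ℕ) (E : Finset ℕ) (H S : ℕ) : Finset ℕ :=
  E.filter fun e => Heavy p k S (firstHit n e k H)

namespace Represents

variable {n k p : ℕ} {E : Finset ℕ} {H S : ℕ}

theorem slot_eq (h : Represents n k p E H S) (hp : 0 < p) (hE : #E ≤ p) {i : ℕ} (hi : i < k) :
    slot p k S i = sketchSum p (2 * k + 1) (E.filter fun e => firstHit n e k H = i).val := by
  rw [slot, h.eq_loadSum, loadSum_eq]
  exact sum_mul_pow_div_mod (R := k + 1)
    (a := fun i => sketchSum p (2 * k + 1) (E.val.filter fun e => firstHit n e k H = i))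
    (by omega) fun r _ => sketchSum_lt hp (card_filter_le' hE _)

theorem heavy_iff (h : Represents n k p E H S) (hp : 1 < p) (hE : #E ≤ p) {i : ℕ} (hi : i < k) :
    Heavy p k S i ↔ k < #(E.filter fun e => firstHit n e k H = i) := by
  rw [Heavy, h.slot_eq (by omega) hE hi, sketchSum_mod hp (by omega)]
  · rfl
  · exact card_filter_le' (m := E.val) hE _

theorem card_light_star_le (h : Represents n k p E H S) (hp : 1 < p) (hE : #E ≤ p) (i : ℕ) :
    #((lightEdges n k p E H S).filter fun e => firstHit n e k H = i) ≤ k := by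
  by_cases hi : i < k ∧ ¬ Heavy p k S i
  · rw [h.heavy_iff hp hE hi.1] at hi
    exact (card_le_card (filter_subset_filter _ (filter_subset _ _))).trans (by omega)
  · rw [filter_eq_empty_iff.2]
    · simp
    · rintro e he rfl
      exact hi ⟨h.firstHit_lt e (filter_subset _ _ he), (mem_filter.1 he).2⟩

theorem card_lightEdges_le (h : Represents n k p E H S) (hp : 1 < p) (hE : #E ≤ p) :
    #(lightEdges n k p E H S) ≤ k * k := by
  rw [card_eq_sum_card_fiberwise (f := fun e => firstHit n e k H) (t := range k)]
  · calc _ ≤ ∑ _i ∈ range k, k := sum_le_sum fun i _ => h.card_light_star_le hp hE i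
      _ = k * k := by simp
  · intro e he
    exact mem_coe.2 (mem_range.2 (h.firstHit_lt e (filter_subset _ _ he)))

theorem lightSlots_eq (h : Represents n k p E H S) (hp : 1 < p) (hE : #E ≤ p) :
    lightSlots k p S = loadSum n k p H (lightEdges n k p E H S).val := by
  rw [loadSum_eq, sum_range_succ, lightSlots]
  have h0 : (lightEdges n k p E H S).val.filter (fun e => firstHit n e k H = k) = 0 :=
    Multiset.filter_eq_nil.2 fun e he => (h.firstHit_lt e (filter_subset _ _ he)).ne
  rw [h0]
  simp only [sketchSum, Multiset.map_zero, Multiset.sum_zero, zero_mul, add_zero]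
  refine sum_congr rfl fun i hi => ?_
  have hi := mem_range.1 hi
  split_ifs with hh
  · rw [Multiset.filter_eq_nil.2]
    · simp
    · rintro e he rfl
      exact (Finset.mem_filter (s := E).1 he).2 hh
  · rw [h.slot_eq (by omega) hE hi, sketchSum]
    congr 3
    rw [filter_val, lightEdges, filter_val, Multiset.filter_filter]
    refine Multiset.filter_congr fun e _ => ?_
    constructor
    · rintro rfl
      exact ⟨rfl, hh⟩
    · exact fun h => h.1

/-- The digits of the rebuilt list that come from heavy stars. -/
theorem digit_heavy (hn : 0 < n) {i : ℕ} (hi : i < k) (hh : Heavy p k S i) (X : ℕ) :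
    (heavyVertices n k p H S + X * n ^ heavyCount k p S) /
      n ^ Nat.count (Heavy p k S) i % n = H / n ^ i % n := by
  rw [heavyVertices_eq, sum_mul_pow_add_div_mod X _ fun r _ => Nat.mod_lt _ hn, Nat.nth_count hh]
  exact Nat.count_strict_mono hh hi

/-- The low digits of the new list are the heavy vertices in their old order, for any `X`. No vertex
of `H` before the centre of `e` is an end of `e`, in particular no heavy one, so the new first hit
is the rank of the old index among the heavy indices. -/
theorem firstHit_heavy (h : Represents n k p E H S) (hn : 0 < n) (X : ℕ) {e : ℕ}
    (he : e ∈ heavyEdges n k p E H S) :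
    firstHit n e k (heavyVertices n k p H S + X * n ^ heavyCount k p S) =
      Nat.count (Heavy p k S) (firstHit n e k H) := by
  obtain ⟨he, hh⟩ := mem_filter.1 he
  have hlt := h.firstHit_lt e he
  refine firstHit_eq ((Nat.count_le _).trans_lt hlt) ?_ ?_
  · unfold Hit
    rw [digit_heavy hn hlt hh]
    exact hit_firstHit hlt
  · intro j hj hhit
    have hj' := Nat.nth_lt_of_lt_count hj
    have hheavy : Heavy p k S (Nat.nth (Heavy p k S) j) := by
      have hjk : j < Nat.count (Heavy p k S) k := hj.trans_le (Nat.count_monotone _ hlt.le)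
      -- `Heavy` is not confined to indices below `k`. If it holds only finitely often, its total
      -- number is still at least the count below `k`, which exceeds `j`.
      refine Nat.nth_mem j fun hf => ?_
      exact hjk.trans_le ((Nat.count_eq_card_filter_range _ _).trans_le
        (card_le_card fun x hx => by simpa using (mem_filter.1 hx).2))
    have hcount : Nat.count (Heavy p k S) (Nat.nth (Heavy p k S) j) = j := by
      refine Nat.count_nth fun hf => ?_
      have hjk : j < Nat.count (Heavy p k S) k := hj.trans_le (Nat.count_monotone _ hlt.le)
      exact hjk.trans_le ((Nat.count_eq_card_filter_range _ _).trans_le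
        (card_le_card fun x hx => by simpa using (mem_filter.1 hx).2))
    have hd := digit_heavy (H := H) (p := p) (S := S) hn (hj'.trans hlt) hheavy X
    rw [hcount] at hd
    unfold Hit at hhit
    rw [hd] at hhit
    exact not_hit_of_lt_firstHit hj' hhit

/-- Heavy stars survive as sets of edges, so moving each heavy slot to its rank yields the load of
the heavy edges for the new list, although these edges are unknown to the algorithm. -/
theorem heavySlots_eq (h : Represents n k p E H S) (hn : 0 < n) (hp : 1 < p) (hE : #E ≤ p)
    (X : ℕ) : heavySlots k p S =
      loadSum n k p (heavyVertices n k p H S + X * n ^ heavyCount k p S)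
        (heavyEdges n k p E H S).val := by
  have h1 : loadSum n k p (heavyVertices n k p H S + X * n ^ heavyCount k p S)
      (heavyEdges n k p E H S).val = ∑ e ∈ heavyEdges n k p E H S,
        sketch p (2 * k + 1) e * sketchBase p k ^ Nat.count (Heavy p k S) (firstHit n e k H) := by
    refine sum_congr rfl fun e he => ?_
    rw [load, h.firstHit_heavy hn X he]
  have h2 : ∀ e ∈ heavyEdges n k p E H S, firstHit n e k H ∈ range k :=
    fun e he => mem_range.2 (h.firstHit_lt e (mem_filter.1 he).1)
  rw [h1, ← sum_fiberwise_of_maps_to h2, heavySlots]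
  refine sum_congr rfl fun i hi => ?_
  have hi := mem_range.1 hi
  split_ifs with hh
  · rw [h.slot_eq (by omega) hE hi]
    have : (heavyEdges n k p E H S).filter (fun e => firstHit n e k H = i) =
        E.filter fun e => firstHit n e k H = i := by
      rw [heavyEdges, filter_filter]
      refine filter_congr fun e _ => ?_
      constructor
      · exact fun h => h.2
      · rintro rfl
        exact ⟨hh, rfl⟩
    rw [this, sketchSum]
    change (∑ e ∈ E.filter (fun e => firstHit n e k H = i), sketch p (2 * k + 1) e) * _ = _
    rw [sum_mul]
    exact sum_congr rfl fun e he => by rw [(mem_filter.1 he).2]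
  · rw [filter_eq_empty_iff.2, sum_empty]
    rintro e he rfl
    exact hh (mem_filter.1 he).2

/-- After replacing the vertices without a heavy star, the new list represents the edges again. -/
theorem rebuild (h : Represents n k p E H S) (hn : 0 < n) (hp : 1 < p) (hE : #E ≤ p) {e : ℕ}
    (he : e ∉ E) (X : ℕ)
    (hX : loadSum n k p (heavyVertices n k p H S + X * n ^ heavyCount k p S)
      (e ::ₘ (lightEdges n k p E H S).val) < sketchBase p k ^ k) :
    Represents n k p (insert e E) (heavyVertices n k p H S + X * n ^ heavyCount k p S)
      (heavySlots k p S + loadSum n k p (heavyVertices n k p H S + X * n ^ heavyCount k p S)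
        (e ::ₘ (lightEdges n k p E H S).val)) := by
  -- The search only tests the new edge and the light edges; the heavy edges remain covered by their
  -- old centres.
  have hlt := forall_of_loadSum_lt hp hX
  have hsplit : E.val = (heavyEdges n k p E H S).val + (lightEdges n k p E H S).val :=
    (Multiset.filter_add_not (fun e => Heavy p k S (firstHit n e k H)) E.val).symm
  constructor
  · rw [h.heavySlots_eq hn hp hE X, insert_val_of_notMem he, hsplit, ← loadSum_add]
    congr 1
    rw [Multiset.add_cons]
  · intro a ha
    by_cases hh : a ∈ heavyEdges n k p E H S
    · rw [h.firstHit_heavy hn X hh]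
      exact (Nat.count_le _).trans_lt (h.firstHit_lt a (filter_subset _ _ hh))
    · apply hlt
      rcases mem_insert.1 ha with rfl | ha
      · exact Multiset.mem_cons_self _ _
      · refine Multiset.mem_cons_of_mem (mem_filter.2 ⟨ha, fun h' => hh (mem_filter.2 ⟨ha, h'⟩)⟩)

/-- The vertices with a heavy star belong to every small vertex cover. -/
theorem mem_cover_of_heavy (h : Represents n k p E H S) (hp : 1 < p) (hE : #E ≤ p)
    (hord : ∀ e ∈ E, e / n < e % n) {T : Finset ℕ} (hT : #T ≤ k)
    (hcov : ∀ e ∈ E, e / n ∈ T ∨ e % n ∈ T) {i : ℕ} (hi : i < k) (hh : Heavy p k S i) :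
    H / n ^ i % n ∈ T := by
  rw [h.heavy_iff hp hE hi] at hh
  by_contra hc
  set u := H / n ^ i % n with hu
  have hstar : ∀ e ∈ E.filter (fun e => firstHit n e k H = i), e ∈ E ∧ (u = e / n ∨ u = e % n) := by
    intro e he
    obtain ⟨heE, rfl⟩ := mem_filter.1 he
    exact ⟨heE, hit_firstHit hi⟩
  -- If the centre `u` is not in `T`, then the other end of each edge of its star is, and the other
  -- end determines the edge.
  have hle : #(E.filter fun e => firstHit n e k H = i) ≤ #T := by
    refine card_le_card_of_injOn (fun e => if e / n = u then e % n else e / n) ?_ ?_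
    · intro e he
      obtain ⟨heE, hue⟩ := hstar e he
      have := hcov e heE
      simp only
      split_ifs with h1
      · rcases this with h2 | h2
        · exact absurd (h1 ▸ h2) hc
        · exact h2
      · rcases this with h2 | h2
        · exact h2
        · rcases hue with h3 | h3
          · exact absurd h3.symm h1
          · exact absurd (h3 ▸ h2) hc
    · intro a ha b hb hab
      obtain ⟨haE, hua⟩ := hstar a ha
      obtain ⟨hbE, hub⟩ := hstar b hb
      have h1 := hord a haE
      have h2 := hord b hbE
      have h3 := Nat.div_add_mod a n
      have h4 := Nat.div_add_mod b n
      simp only at hab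
      have : a / n = b / n ∧ a % n = b % n := by
        split_ifs at hab <;> omega
      rw [← h3, ← h4, this.1, this.2]
  omega

/-- A small vertex cover yields a way to replace the vertices without a heavy star. -/
theorem exists_rebuild (h : Represents n k p E H S) (hn : 0 < n) (hp : 1 < p) (hE : #E ≤ p)
    (hkp : k * k < p) (hord : ∀ e ∈ E, e / n < e % n) {e₀ : ℕ} {T : Finset ℕ} (hT : #T ≤ k)
    (hTn : ∀ t ∈ T, t < n) (hcov : ∀ e ∈ insert e₀ E, e / n ∈ T ∨ e % n ∈ T) :
    ∃ X < n ^ k, loadSum n k p (heavyVertices n k p H S + X * n ^ heavyCount k p S)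
      (e₀ ::ₘ (lightEdges n k p E H S).val) < sketchBase p k ^ k := by
  set V : Finset ℕ := ((range k).filter (Heavy p k S)).image fun i => H / n ^ i % n with hV
  have hVT : V ⊆ T := by
    intro v hv
    obtain ⟨i, hi, rfl⟩ := mem_image.1 hv
    obtain ⟨hi, hh⟩ := mem_filter.1 hi
    exact h.mem_cover_of_heavy hp hE hord hT (fun e he => hcov e (mem_insert_of_mem he))
      (mem_range.1 hi) hh
  -- A heavy star contains an edge, and an edge charged to index `j` avoids all earlier vertices. So
  -- a heavy vertex repeats no earlier digit, and the heavy vertices are distinct.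
  have hlt : ∀ i j, i < j → j < k → Heavy p k S j → H / n ^ i % n ≠ H / n ^ j % n := by
    intro i j hij hj hh heq
    rw [h.heavy_iff hp hE hj] at hh
    obtain ⟨e, he⟩ := card_pos.1 (lt_of_le_of_lt (Nat.zero_le _) hh)
    obtain ⟨_, rfl⟩ := mem_filter.1 he
    refine not_hit_of_lt_firstHit hij ?_
    unfold Hit
    rw [heq]
    exact hit_firstHit hj
  have hVc : #V = heavyCount k p S := by
    rw [hV, card_image_of_injOn, heavyCount, Nat.count_eq_card_filter_range]
    intro i hi j hj hij
    obtain ⟨hi, hhi⟩ := mem_filter.1 hi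
    obtain ⟨hj, hhj⟩ := mem_filter.1 hj
    rcases lt_trichotomy i j with hlt' | rfl | hlt'
    · exact absurd hij (hlt i j hlt' (mem_range.1 hj) hhj)
    · rfl
    · exact absurd hij.symm (hlt j i hlt' (mem_range.1 hi) hhi)
  -- The witness lists the rest of the promised cover; as the heavy vertices are distinct members of
  -- `T`, it fits into the remaining digits.
  obtain ⟨X, hX, hdig⟩ := exists_digits_of_finset (b := n) (T \ V) fun t ht =>
    hTn t (mem_sdiff.1 ht).1
  have hcard : #(T \ V) + heavyCount k p S ≤ k := by
    rw [← hVc, card_sdiff_of_subset hVT]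
    have := card_le_card hVT
    omega
  refine ⟨X, hX.trans_le (Nat.pow_le_pow_right hn (by omega)), ?_⟩
  have hdigits : ∀ t ∈ T, ∃ j < k,
      (heavyVertices n k p H S + X * n ^ heavyCount k p S) / n ^ j % n = t := by
    intro t ht
    by_cases htV : t ∈ V
    · obtain ⟨i, hi, rfl⟩ := mem_image.1 htV
      obtain ⟨hi, hh⟩ := mem_filter.1 hi
      have hi := mem_range.1 hi
      exact ⟨_, (Nat.count_le _).trans_lt hi, digit_heavy hn hi hh X⟩
    · obtain ⟨j, hj, hj'⟩ := hdig t (mem_sdiff.2 ⟨ht, htV⟩)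
      refine ⟨heavyCount k p S + j, by omega, ?_⟩
      rw [pow_add, ← Nat.div_div_eq_div_mul, Nat.add_mul_div_right _ _ (by positivity),
        Nat.div_eq_of_lt (heavyVertices_lt hn _ _ _ _), zero_add, hj']
  refine loadSum_lt_of_forall (by omega) ?_ ?_
  · have := h.card_lightEdges_le hp hE
    rw [Multiset.card_cons]
    change #(lightEdges n k p E H S) + 1 ≤ p
    omega
  · intro e he
    have heE : e ∈ insert e₀ E := by
      rcases Multiset.mem_cons.1 he with rfl | he
      · exact mem_insert_self _ _
      · exact mem_insert_of_mem (filter_subset _ _ he)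
    rcases hcov e heE with ht | ht
    · obtain ⟨j, hj, hj'⟩ := hdigits _ ht
      exact firstHit_lt_of_hit hj (Or.inl hj')
    · obtain ⟨j, hj, hj'⟩ := hdigits _ ht
      exact firstHit_lt_of_hit hj (Or.inr hj')

/-- The light edges can be recovered from their packed sketches. -/
theorem eq_lightEdges (h : Represents n k p E H S) (hp : p.Prime) (hk : k < p) (hE : #E ≤ p)
    (hEp : ∀ e ∈ E, e < p) {m : Multiset ℕ} (hm : ∀ a ∈ m, a < p) (hc : m.card ≤ p)
    (heq : loadSum n k p H m = lightSlots k p S) : m = (lightEdges n k p E H S).val := by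
  rw [h.lightSlots_eq hp.one_lt hE] at heq
  exact (multiset_eq_of_loadSum_eq hp hk (fun a ha => hEp a (filter_subset _ _ ha)) hm
    ((card_le_card (filter_subset _ _)).trans hE) hc
    (fun i => h.card_light_star_le hp.one_lt hE i) heq.symm).symm

end Represents

/-! ### The cells and subroutines of the algorithm -/

namespace Expr

/-- The content of the cell `a`. -/
def reg (a : ℕ) : Expr := .mem (.lit a)

instance : Add Expr := ⟨.op .add⟩
instance : Sub Expr := ⟨.op .sub⟩
instance : Mul Expr := ⟨.op .mul⟩
instance : Div Expr := ⟨.op .div⟩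
instance : Mod Expr := ⟨.op .mod⟩

variable (M : ℕ →₀ ℕ) (a b : Expr)

@[simp] theorem val_reg (c : ℕ) : (reg c).val M = M c := rfl
@[simp] theorem val_lit (c : ℕ) : (lit c).val M = c := rfl
@[simp] theorem val_add : (a + b).val M = a.val M + b.val M := rfl
@[simp] theorem val_sub : (a - b).val M = a.val M - b.val M := rfl
@[simp] theorem val_mul : (a * b).val M = a.val M * b.val M := rfl
@[simp] theorem val_div : (a / b).val M = a.val M / b.val M := rfl
@[simp] theorem val_mod : (a % b).val M = a.val M % b.val M := rfl
@[simp] theorem val_eq : (op .eq a b).val M = if a.val M = b.val M then 1 else 0 := rfl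
@[simp] theorem val_lt : (op .lt a b).val M = if a.val M < b.val M then 1 else 0 := rfl

theorem val_lt_ne_zero : (op .lt a b).val M ≠ 0 ↔ a.val M < b.val M := by
  rw [val_lt]
  split_ifs with h <;> simp [h]

theorem val_lt_eq_zero : (op .lt a b).val M = 0 ↔ b.val M ≤ a.val M := by
  rw [← not_lt, ← val_lt_ne_zero, not_not]

end Expr

/-- Store the value of `e` in the cell `a`. -/
def put (a : ℕ) (e : Expr) : Cmd := .assign (.lit a) e

infix:62 "::=" => put
infixr:60 ";;" => Cmd.seq

theorem WP.put {B a : ℕ} {e : Expr} {Q : (ℕ →₀ ℕ) → Prop} {M : ℕ →₀ ℕ} (h : e.val M < 2 ^ B)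
    (hQ : Q (M.update a (e.val M))) : WP B (a ::= e) Q M := WP.assign h hQ

theorem WP.put_seq {B a : ℕ} {e : Expr} {q : Cmd} {Q : (ℕ →₀ ℕ) → Prop} {M : ℕ →₀ ℕ}
    (h : e.val M < 2 ^ B) (hQ : WP B q Q (M.update a (e.val M))) :
    WP B (a ::= e ;; q) Q M := WP.seq (WP.assign h hQ)

notation "cell_n" => (0 : ℕ)
notation "cell_k" => (1 : ℕ)
notation "cell_ins" => (3 : ℕ)
notation "cell_u" => (4 : ℕ)
notation "cell_v" => (5 : ℕ)
notation "cell_N" => (6 : ℕ)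
notation "cell_p" => (7 : ℕ)
notation "cell_Q" => (8 : ℕ)
notation "cell_Z" => (9 : ℕ)
notation "cell_Zk" => (10 : ℕ)
notation "cell_H" => (11 : ℕ)
notation "cell_S" => (12 : ℕ)
notation "cell_Y" => (13 : ℕ)
notation "cell_G" => (14 : ℕ)
notation "cell_acc" => (15 : ℕ)
notation "cell_T" => (16 : ℕ)
notation "cell_e" => (17 : ℕ)
notation "cell_i" => (18 : ℕ)
notation "cell_U" => (19 : ℕ)
notation "cell_z" => (20 : ℕ)
notation "cell_F" => (21 : ℕ)
notation "cell_w" => (22 : ℕ)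
notation "cell_q" => (23 : ℕ)
notation "cell_r" => (24 : ℕ)
notation "cell_edge" => (25 : ℕ)
notation "cell_j" => (26 : ℕ)
notation "cell_heavyH" => (27 : ℕ)
notation "cell_heavyS" => (28 : ℕ)
notation "cell_lightS" => (29 : ℕ)
notation "cell_pn" => (30 : ℕ)
notation "cell_pz" => (31 : ℕ)
notation "cell_qz" => (32 : ℕ)
notation "cell_restS" => (33 : ℕ)
notation "cell_restH" => (34 : ℕ)
notation "cell_X" => (35 : ℕ)

open StreamRAM.Expr in
/-- Compute the sketch of `e`. -/
def sketchCmd : Cmd :=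
  cell_F ::= lit 0 ;; cell_w ::= lit 1 ;; cell_q ::= lit 1 ;; cell_r ::= lit 0 ;;
  .loop (op .lt (reg cell_r) (reg cell_k + reg cell_k + lit 1))
    (cell_F ::= reg cell_F + reg cell_w * reg cell_q ;;
      cell_w ::= reg cell_w * reg cell_e % reg cell_p ;;
      cell_q ::= reg cell_q * reg cell_Q ;;
      cell_r ::= reg cell_r + lit 1)

open StreamRAM.Expr in
/-- Compute the power of `Z` whose exponent is the index of the first vertex of `G` that is an end
of `e`. -/
def findCmd : Cmd :=
  cell_i ::= lit 0 ;; cell_U ::= reg cell_G ;; cell_z ::= lit 1 ;;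
  .loop (op .lt (reg cell_i) (reg cell_k) *
      ((lit 1 - op .eq (reg cell_U % reg cell_n) (reg cell_e / reg cell_n)) *
        (lit 1 - op .eq (reg cell_U % reg cell_n) (reg cell_e % reg cell_n))))
    (cell_U ::= reg cell_U / reg cell_n ;;
      cell_z ::= reg cell_z * reg cell_Z ;;
      cell_i ::= reg cell_i + lit 1)

open StreamRAM.Expr in
/-- Add up the loads of the edges in the list `Y` with respect to the list of vertices `G`. -/
def loadCmd : Cmd :=
  cell_T ::= reg cell_Y ;; cell_acc ::= lit 0 ;;
  .loop (reg cell_T)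
    (cell_e ::= reg cell_T % reg cell_N ;;
      cell_T ::= reg cell_T / reg cell_N ;;
      findCmd ;; sketchCmd ;;
      cell_acc ::= reg cell_acc + reg cell_F * reg cell_z)

/-- Assumptions on the parameters: `p` is a prime exceeding the codes of edges, and the cells are
long enough. -/
structure Params (n k p B : ℕ) : Prop where
  two_le : 2 ≤ n
  k_le : k ≤ n
  prime : p.Prime
  le_p : n * n + 2 ≤ p
  lt_pow : sketchBase p k ^ (k + 3) < 2 ^ B

/-- The cells that hold the parameters. -/
structure Ready (n k p : ℕ) (M : ℕ →₀ ℕ) : Prop where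
  hn : M cell_n = n
  hk : M cell_k = k
  hN : M cell_N = n * n
  hp : M cell_p = p
  hQ : M cell_Q = p * p
  hZ : M cell_Z = sketchBase p k
  hZk : M cell_Zk = sketchBase p k ^ k

theorem Ready.of_eq {n k p : ℕ} {M M' : ℕ →₀ ℕ} (h : Ready n k p M)
    (h0 : M' cell_n = M cell_n) (h1 : M' cell_k = M cell_k) (h2 : M' cell_N = M cell_N)
    (h3 : M' cell_p = M cell_p) (h4 : M' cell_Q = M cell_Q) (h5 : M' cell_Z = M cell_Z)
    (h6 : M' cell_Zk = M cell_Zk) : Ready n k p M' :=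
  ⟨h0.trans h.hn, h1.trans h.hk, h2.trans h.hN, h3.trans h.hp, h4.trans h.hQ, h5.trans h.hZ,
    h6.trans h.hZk⟩

/-! ### Size estimates for the numbers stored by the algorithm. -/

namespace Params

variable {n k p B : ℕ}

theorem one_lt_p (h : Params n k p B) : 1 < p := h.prime.one_lt

theorem p_le (h : Params n k p B) : p ≤ sketchBase p k := by
  have h1 := h.one_lt_p
  calc p ≤ p * p := by nlinarith
    _ = (p * p) ^ 1 := (pow_one _).symm
    _ ≤ sketchBase p k := Nat.pow_le_pow_right (by positivity) (by omega)

theorem lt_of_le_pow (h : Params n k p B) {x j : ℕ} (hx : x ≤ sketchBase p k ^ j)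
    (hj : j ≤ k + 3) : x < 2 ^ B :=
  (hx.trans (Nat.pow_le_pow_right (sketchBase_pos h.prime.pos k) hj)).trans_lt h.lt_pow

theorem lt_of_le_base (h : Params n k p B) {x : ℕ} (hx : x ≤ sketchBase p k) : x < 2 ^ B :=
  h.lt_of_le_pow (j := 1) (by simpa using hx) (by omega)

theorem lt_of_le_p (h : Params n k p B) {x : ℕ} (hx : x ≤ p) : x < 2 ^ B :=
  h.lt_of_le_base (hx.trans h.p_le)

theorem sq_lt_p (h : Params n k p B) : k * k + 1 < p := by
  have := Nat.mul_le_mul h.k_le h.k_le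
  have := h.le_p
  omega

theorem lt_of_le_p_pow (h : Params n k p B) {x j : ℕ} (hx : x ≤ p ^ j)
    (hj : j ≤ 2 * (2 * k + 1) * (k + 3)) : x < 2 ^ B := by
  refine h.lt_of_le_pow (j := k + 3) (hx.trans ?_) le_rfl
  rw [sketchBase, ← pow_two, ← pow_mul, ← pow_mul, ← mul_assoc]
  exact Nat.pow_le_pow_right h.prime.pos hj

theorem k_lt_p (h : Params n k p B) : k < p := by
  have := h.sq_lt_p
  have := Nat.le_mul_self k
  omega

/-- The exponent allows for `k * k` light edges and the new edge. -/
theorem lt_of_le_list (h : Params n k p B) {x : ℕ} (hx : x ≤ (n * n) ^ (k * k + 1)) :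
    x < 2 ^ B := by
  have hnp : n * n ≤ p := by have := h.le_p; omega
  refine h.lt_of_le_p_pow (j := k * k + 1) (hx.trans (Nat.pow_le_pow_left hnp _)) ?_
  have : 2 * (2 * k + 1) * (k + 3) = 4 * (k * k) + 14 * k + 6 := by ring
  omega

end Params

/-! ### Correctness of the programs for sketches, first hits and loads. -/

theorem sketchCmd_spec {n k p B : ℕ} (hP : Params n k p B) {M : ℕ →₀ ℕ} (hM : Ready n k p M) :
    WP B sketchCmd (fun M' => M' cell_F = sketch p (2 * k + 1) (M cell_e)) M := by
  have hp := hP.one_lt_p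
  have h2k : 2 * k + 1 < p := by nlinarith [hP.k_le, hP.le_p, hP.two_le]
  have h1 := hP.lt_of_le_p (x := 1) (by omega)
  have h0 := hP.lt_of_le_p (x := 0) (by omega)
  unfold sketchCmd
  refine WP.put_seq h0 (WP.put_seq h1 (WP.put_seq h1 (WP.put_seq h0 ?_)))
  refine WP.loop (P := fun M' => M' cell_r ≤ 2 * k + 1 ∧
      M' cell_F = sketch p (M' cell_r) (M cell_e) ∧
      M' cell_w = M cell_e ^ M' cell_r % p ∧ M' cell_q = (p * p) ^ M' cell_r)
    (fun M' => 2 * k + 1 - M' cell_r) ?_ ?_ ?_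
  · simp [sketch, Nat.mod_eq_of_lt hp]
  · rintro M' hf ⟨hr, hF, hw, hq⟩ hlt
    have e1 : M' cell_k = k := by rw [hf cell_k (by decide)]; simp [hM.hk]
    have e2 : M' cell_e = M cell_e := by rw [hf cell_e (by decide)]; simp
    have e3 : M' cell_p = p := by rw [hf cell_p (by decide)]; simp [hM.hp]
    have e4 : M' cell_Q = p * p := by rw [hf cell_Q (by decide)]; simp [hM.hQ]
    have hlt : M' cell_r < 2 * k + 1 := by
      by_contra hc
      apply hlt
      simp [e1]
      omega
    have hS : M' cell_F + M' cell_w * M' cell_q = sketch p (M' cell_r + 1) (M cell_e) := by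
      rw [hF, hw, hq, sketch, sketch, sum_range_succ]
    have hlt1 : sketch p (M' cell_r + 1) (M cell_e) < (p * p) ^ (M' cell_r + 1) := by
      simpa [sketchSum] using
        sketchSum_lt (R := M' cell_r + 1) (by omega : 0 < p) (m := {M cell_e}) (by simp; omega)
    have hle : (p * p) ^ (M' cell_r + 1) ≤ sketchBase p k :=
      Nat.pow_le_pow_right (by positivity) (by omega)
    refine WP.put_seq ?_ (WP.put_seq ?_ (WP.put_seq ?_ (WP.put ?_ ?_)))
    · simp only [Expr.val_add, Expr.val_mul, Expr.val_reg, hS]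
      exact hP.lt_of_le_base (by omega)
    · simp [e3]
      exact hP.lt_of_le_p (Nat.mod_lt _ (by omega)).le
    · simp [e4, hq, ← pow_succ]
      exact hP.lt_of_le_base hle
    · simp
      exact hP.lt_of_le_p (by omega)
    · have hw' : M' cell_w * M cell_e % p = M cell_e ^ (M' cell_r + 1) % p := by
        rw [hw, pow_succ, Nat.mod_mul_mod]
      have hq' : M' cell_q * (p * p) = (p * p) ^ (M' cell_r + 1) := by rw [hq, pow_succ]
      simp [hS, e2, e3, e4, hw', hq']
      omega
  · rintro M' hf ⟨hr, hF, -, -⟩ hge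
    have e1 : M' cell_k = k := by rw [hf cell_k (by decide)]; simp [hM.hk]
    have : M' cell_r = 2 * k + 1 := by
      simp [e1] at hge
      omega
    rw [hF, this]

theorem findCmd_spec {n k p B : ℕ} (hP : Params n k p B) {M : ℕ →₀ ℕ} (hM : Ready n k p M)
    (hG : M cell_G < 2 ^ B) :
    WP B findCmd
      (fun M' => M' cell_z = sketchBase p k ^ firstHit n (M cell_e) k (M cell_G)) M := by
  have h1 := hP.lt_of_le_p (x := 1) hP.one_lt_p.le
  have h0 := hP.lt_of_le_p (x := 0) (by omega)
  have hkp := hP.k_lt_p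
  unfold findCmd
  refine WP.put_seq h0 (WP.put_seq (by simpa) (WP.put_seq h1 ?_))
  -- The power accumulated so far, times the power still due for the rest of the list, is the final
  -- power. This also bounds the partial power by the final one.
  refine WP.loop (P := fun M' => M' cell_i ≤ k ∧ M' cell_U < 2 ^ B ∧
      M' cell_z * sketchBase p k ^ firstHit n (M cell_e) (k - M' cell_i) (M' cell_U) =
        sketchBase p k ^ firstHit n (M cell_e) k (M cell_G))
    (fun M' => k - M' cell_i) ?_ ?_ ?_
  · simpa using hG
  · rintro M' hf ⟨hi, hU, hz⟩ hc
    have e0 : M' cell_n = n := by rw [hf cell_n (by decide)]; simp [hM.hn]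
    have e1 : M' cell_k = k := by rw [hf cell_k (by decide)]; simp [hM.hk]
    have e2 : M' cell_e = M cell_e := by rw [hf cell_e (by decide)]; simp
    have e3 : M' cell_Z = sketchBase p k := by rw [hf cell_Z (by decide)]; simp [hM.hZ]
    simp [e0, e1, e2] at hc
    obtain ⟨hc1, hc2, hc3⟩ := hc
    obtain ⟨l, hl⟩ : ∃ l, k - M' cell_i = l + 1 := ⟨k - M' cell_i - 1, by omega⟩
    have hl' : k - (M' cell_i + 1) = l := by omega
    have hc' : ¬ (M' cell_U % n = M cell_e / n ∨ M' cell_U % n = M cell_e % n) := by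
      rintro (h | h) <;> simp [h] at hc2 hc3
    rw [hl, firstHit, if_neg hc', pow_succ'] at hz
    have hz' : M' cell_z * sketchBase p k *
        sketchBase p k ^ firstHit n (M cell_e) l (M' cell_U / n) =
        sketchBase p k ^ firstHit n (M cell_e) k (M cell_G) := by rw [← hz]; ring
    refine WP.put_seq ?_ (WP.put_seq ?_ (WP.put ?_ ?_))
    · simp
      exact (Nat.div_le_self _ _).trans_lt hU
    · simp [e3]
      refine hP.lt_of_le_pow (j := firstHit n (M cell_e) k (M cell_G)) ?_ ?_
      · rw [← hz']
        exact Nat.le_mul_of_pos_right _ (pow_pos (sketchBase_pos hP.prime.pos k) _)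
      · have := firstHit_le n (M cell_e) k (M cell_G)
        omega
    · simp
      exact hP.lt_of_le_p (by omega)
    · simp [e0, e3, hl', hz']
      exact ⟨⟨by omega, (Nat.div_le_self _ _).trans_lt hU⟩, by omega⟩
  · rintro M' hf ⟨hi, hU, hz⟩ hc
    have e0 : M' cell_n = n := by rw [hf cell_n (by decide)]; simp [hM.hn]
    have e1 : M' cell_k = k := by rw [hf cell_k (by decide)]; simp [hM.hk]
    have e2 : M' cell_e = M cell_e := by rw [hf cell_e (by decide)]; simp
    have : firstHit n (M cell_e) (k - M' cell_i) (M' cell_U) = 0 := by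
      by_cases hik : M' cell_i < k
      · obtain ⟨l, hl⟩ : ∃ l, k - M' cell_i = l + 1 := ⟨k - M' cell_i - 1, by omega⟩
        rw [hl, firstHit, if_pos]
        by_contra hne
        rw [not_or] at hne
        simp [e0, e1, e2, hne.1, hne.2] at hc
        omega
      · have : k - M' cell_i = 0 := by omega
        rw [this, firstHit]
    rw [← hz, this, pow_zero, mul_one]

/-- The list of edges coded by `Y`. -/
def edgesOf (n Y : ℕ) : Multiset ℕ := (Nat.digits (n * n) Y : Multiset ℕ)

theorem card_edgesOf_le {n Y l : ℕ} (hn : 2 ≤ n) (hY : Y < (n * n) ^ l) :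
    (edgesOf n Y).card ≤ l := by
  have : 1 < n * n := by nlinarith
  simpa [edgesOf] using (Nat.digits_length_le_iff this Y).2 hY

theorem edgesOf_of_ne_zero {n Y : ℕ} (hn : 2 ≤ n) (hY : Y ≠ 0) :
    edgesOf n Y = (Y % (n * n)) ::ₘ edgesOf n (Y / (n * n)) := by
  have : 1 < n * n := by nlinarith
  rw [edgesOf, Nat.digits_def' this (by omega)]
  rfl

theorem loadCmd_spec {n k p B : ℕ} (hP : Params n k p B) {M : ℕ →₀ ℕ} (hM : Ready n k p M)
    (hG : M cell_G < 2 ^ B) (hY : M cell_Y < (n * n) ^ (k * k + 1)) :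
    WP B loadCmd
      (fun M' => M' cell_acc = loadSum n k p (M cell_G) (edgesOf n (M cell_Y))) M := by
  have h0 := hP.lt_of_le_p (x := 0) (by omega)
  have hYB : M cell_Y < 2 ^ B := hP.lt_of_le_list hY.le
  -- At most `k * k + 1 ≤ p ≤ sketchBase p k` edges, each of load at most `sketchBase p k ^ (k +
  -- 1)`, uncovered edges included. The partial sums are below this total.
  have htot : loadSum n k p (M cell_G) (edgesOf n (M cell_Y)) < 2 ^ B := by
    refine hP.lt_of_le_pow (j := k + 2) ?_ (by omega)
    refine (loadSum_le hP.one_lt_p _).trans ?_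
    rw [pow_succ' _ (k + 1)]
    refine Nat.mul_le_mul_right _ ?_
    exact (card_edgesOf_le hP.two_le hY).trans (hP.sq_lt_p.le.trans hP.p_le)
  unfold loadCmd
  refine WP.put_seq (by simpa) (WP.put_seq h0 ?_)
  refine WP.loop (P := fun M' => M' cell_T < 2 ^ B ∧
      M' cell_acc + loadSum n k p (M cell_G) (edgesOf n (M' cell_T)) =
        loadSum n k p (M cell_G) (edgesOf n (M cell_Y)))
    (fun M' => M' cell_T) ?_ ?_ ?_
  · simpa using hYB
  · rintro M' hf ⟨hT, hacc⟩ hne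
    have hne : M' cell_T ≠ 0 := hne
    have hR : Ready n k p M' := hM.of_eq
      (by rw [hf _ (by decide)]; simp) (by rw [hf _ (by decide)]; simp)
      (by rw [hf _ (by decide)]; simp) (by rw [hf _ (by decide)]; simp)
      (by rw [hf _ (by decide)]; simp) (by rw [hf _ (by decide)]; simp)
      (by rw [hf _ (by decide)]; simp)
    have eG : M' cell_G = M cell_G := by rw [hf _ (by decide)]; simp
    rw [edgesOf_of_ne_zero hP.two_le hne, loadSum, Multiset.map_cons, Multiset.sum_cons,
      ← loadSum, ← add_assoc] at hacc
    have hN : M' cell_N = n * n := hR.hN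
    refine WP.put_seq (by simpa using (Nat.mod_le _ _).trans_lt hT)
      (WP.put_seq (by simpa using (Nat.div_le_self _ _).trans_lt hT) (WP.seq ?_))
    have hR1 : Ready n k p ((M'.update cell_e
        ((Expr.reg cell_T % Expr.reg cell_N).val M')).update cell_T
        ((Expr.reg cell_T / Expr.reg cell_N).val (M'.update cell_e
        ((Expr.reg cell_T % Expr.reg cell_N).val M')))) := by
      refine hR.of_eq ?_ ?_ ?_ ?_ ?_ ?_ ?_ <;> simp
    refine (findCmd_spec hP hR1 (by simpa [eG] using hG)).imp fun M₁ hf₁ hz => WP.seq ?_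
    have hR2 : Ready n k p M₁ := by
      refine hR1.of_eq ?_ ?_ ?_ ?_ ?_ ?_ ?_ <;> exact hf₁ _ (by decide)
    refine (sketchCmd_spec hP hR2).imp fun M₂ hf₂ hF => ?_
    have ee : M₁ cell_e = M' cell_T % (n * n) := by
      rw [hf₁ _ (by decide)]; simp [hN]
    have ea : M₂ cell_acc = M' cell_acc := by
      rw [hf₂ _ (by decide), hf₁ _ (by decide)]; simp
    have eT : M₂ cell_T = M' cell_T / (n * n) := by
      rw [hf₂ _ (by decide), hf₁ _ (by decide)]; simp [hN]
    have ez : M₂ cell_z = M₁ cell_z := hf₂ _ (by decide)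
    simp [eG, hN] at hz
    have hval : M₂ cell_acc + M₂ cell_F * M₂ cell_z =
        M' cell_acc + load n k p (M cell_G) (M' cell_T % (n * n)) := by
      rw [ea, hF, ez, hz, ee, load]
    refine WP.put ?_ ?_
    · simp [hval]
      omega
    · simp [hval, eT]
      refine ⟨⟨(Nat.div_le_self _ _).trans_lt hT, hacc⟩, ?_⟩
      exact Nat.div_lt_self (by omega) (by nlinarith [hP.two_le])
  · rintro M' hf ⟨-, hacc⟩ h0
    have h0 : M' cell_T = 0 := h0
    rw [← hacc, h0]
    simp [edgesOf, loadSum]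

open StreamRAM.Expr in
/-- Separate the heavy stars from the light ones. -/
def separateCmd : Cmd :=
  cell_j ::= lit 0 ;; cell_heavyH ::= lit 0 ;; cell_heavyS ::= lit 0 ;; cell_lightS ::= lit 0 ;;
  cell_pn ::= lit 1 ;; cell_pz ::= lit 1 ;; cell_qz ::= lit 1 ;;
  cell_restS ::= reg cell_S ;; cell_restH ::= reg cell_H ;;
  .loop (op .lt (reg cell_j) (reg cell_k))
    (.ite (op .lt (reg cell_k) (reg cell_restS % reg cell_Z % reg cell_Q))
      (cell_heavyH ::= reg cell_heavyH + reg cell_restH % reg cell_n * reg cell_pn ;;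
        cell_heavyS ::= reg cell_heavyS + reg cell_restS % reg cell_Z * reg cell_pz ;;
        cell_pn ::= reg cell_pn * reg cell_n ;;
        cell_pz ::= reg cell_pz * reg cell_Z)
      (cell_lightS ::= reg cell_lightS + reg cell_restS % reg cell_Z * reg cell_qz) ;;
    cell_qz ::= reg cell_qz * reg cell_Z ;;
    cell_restS ::= reg cell_restS / reg cell_Z ;;
    cell_restH ::= reg cell_restH / reg cell_n ;;
    cell_j ::= reg cell_j + lit 1)

open StreamRAM.Expr in
/-- Search for the list of the light edges. -/
def decodeCmd : Cmd :=
  cell_Y ::= lit 0 ;; cell_G ::= reg cell_H ;; loadCmd ;;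
  .loop (lit 1 - op .eq (reg cell_acc) (reg cell_lightS))
    (cell_Y ::= reg cell_Y + lit 1 ;; loadCmd)

open StreamRAM.Expr in
/-- Search for an extension of the list of the heavy vertices that covers the edges in `Y`. -/
def coverCmd : Cmd :=
  cell_X ::= lit 0 ;; cell_G ::= reg cell_heavyH ;; loadCmd ;;
  .loop (lit 1 - op .lt (reg cell_acc) (reg cell_Zk))
    (cell_X ::= reg cell_X + lit 1 ;;
      cell_G ::= reg cell_heavyH + reg cell_X * reg cell_pn ;;
      loadCmd)

open StreamRAM.Expr in
/-- Replace the vertices without a heavy star, so that the new edge is covered, too. -/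
def rebuildCmd : Cmd :=
  separateCmd ;; decodeCmd ;;
  cell_Y ::= reg cell_Y * reg cell_N + reg cell_edge ;;
  coverCmd ;;
  cell_S ::= reg cell_heavyS + reg cell_acc ;;
  cell_H ::= reg cell_G

open StreamRAM.Expr in
/-- Process an update of the stream. -/
def updateCmd : Cmd :=
  cell_edge ::= op .lt (reg cell_u) (reg cell_v) * (reg cell_u * reg cell_n + reg cell_v) +
    op .lt (reg cell_v) (reg cell_u) * (reg cell_v * reg cell_n + reg cell_u) ;;
  cell_Y ::= reg cell_edge ;; cell_G ::= reg cell_H ;; loadCmd ;;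
  .ite (op .lt (reg cell_acc) (reg cell_Zk))
    (.ite (reg cell_ins)
      (cell_S ::= reg cell_S + reg cell_acc)
      (cell_S ::= reg cell_S - reg cell_acc))
    rebuildCmd

/-! ### Correctness of separation, decoding and the search for a new list. -/

theorem heavySlots_lt {p : ℕ} (hp : 0 < p) (k S : ℕ) :
    heavySlots k p S < sketchBase p k ^ heavyCount k p S := by
  have h := sum_ite_count (Heavy p k S) (fun i r => slot p k S i * sketchBase p k ^ r) k
  rw [heavySlots, h]
  exact sum_mul_pow_lt fun r _ => Nat.mod_lt _ (sketchBase_pos hp k)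

theorem lightSlots_lt {p : ℕ} (hp : 0 < p) (k S : ℕ) :
    lightSlots k p S < sketchBase p k ^ k := by
  have h : lightSlots k p S = ∑ i ∈ range k,
      (if Heavy p k S i then 0 else slot p k S i) * sketchBase p k ^ i := by
    refine sum_congr rfl fun i _ => ?_
    split_ifs <;> simp
  rw [h]
  refine sum_mul_pow_lt fun r _ => ?_
  have := sketchBase_pos hp k
  split_ifs
  · exact this
  · exact Nat.mod_lt _ this

theorem Params.pow_n_lt {n k p B : ℕ} (hP : Params n k p B) {x : ℕ} (hx : x ≤ 2 * n ^ (2 * k)) :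
    x < 2 ^ B := by
  have hnp : n ≤ p := by nlinarith [hP.le_p, hP.two_le]
  refine hP.lt_of_le_p_pow (j := 2 * k + 1) (hx.trans ?_) (by nlinarith)
  rw [pow_succ']
  exact Nat.mul_le_mul (hP.two_le.trans hnp) (Nat.pow_le_pow_left hnp _)

theorem Params.pow_n_lt' {n k p B : ℕ} (hP : Params n k p B) {j : ℕ} (hj : j ≤ k) :
    n ^ j < 2 ^ B := by
  refine hP.pow_n_lt ?_
  have : n ^ j ≤ n ^ (2 * k) := Nat.pow_le_pow_right (by have := hP.two_le; omega) (by omega)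
  omega

theorem separateCmd_spec {n k p B : ℕ} (hP : Params n k p B) {M : ℕ →₀ ℕ} (hM : Ready n k p M)
    (hH : M cell_H < 2 ^ B) (hS : M cell_S < 2 ^ B) :
    WP B separateCmd (fun M' =>
      M' cell_heavyH = heavyVertices n k p (M cell_H) (M cell_S) ∧
      M' cell_heavyS = heavySlots k p (M cell_S) ∧
      M' cell_lightS = lightSlots k p (M cell_S) ∧
      M' cell_pn = n ^ heavyCount k p (M cell_S)) M := by
  have h1 := hP.lt_of_le_p (x := 1) hP.one_lt_p.le
  have h0 := hP.lt_of_le_p (x := 0) (by omega)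
  have hn : 0 < n := by have := hP.two_le; omega
  have hkp := hP.k_lt_p
  have hcnt : ∀ j, Nat.count (Heavy p k (M cell_S)) j ≤ j := fun j => Nat.count_le _
  unfold separateCmd
  refine WP.put_seq h0 (WP.put_seq h0 (WP.put_seq h0 (WP.put_seq h0 (WP.put_seq h1
    (WP.put_seq h1 (WP.put_seq h1 (WP.put_seq (by simpa) (WP.put_seq (by simpa) ?_))))))))
  refine WP.loop (P := fun M' => M' cell_j ≤ k ∧
      M' cell_heavyH = (∑ i ∈ range (M' cell_j), if Heavy p k (M cell_S) i then
        M cell_H / n ^ i % n * n ^ Nat.count (Heavy p k (M cell_S)) i else 0) ∧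
      M' cell_heavyS = (∑ i ∈ range (M' cell_j), if Heavy p k (M cell_S) i then
        slot p k (M cell_S) i * sketchBase p k ^ Nat.count (Heavy p k (M cell_S)) i else 0) ∧
      M' cell_lightS = (∑ i ∈ range (M' cell_j), if Heavy p k (M cell_S) i then 0 else
        slot p k (M cell_S) i * sketchBase p k ^ i) ∧
      M' cell_pn = n ^ Nat.count (Heavy p k (M cell_S)) (M' cell_j) ∧
      M' cell_pz = sketchBase p k ^ Nat.count (Heavy p k (M cell_S)) (M' cell_j) ∧
      M' cell_qz = sketchBase p k ^ M' cell_j ∧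
      M' cell_restS = M cell_S / sketchBase p k ^ M' cell_j ∧
      M' cell_restH = M cell_H / n ^ M' cell_j)
    (fun M' => k - M' cell_j) ?_ ?_ ?_
  · simp
  · rintro M' hf ⟨hj, hhH, hhS, hlS, hpn, hpz, hqz, hS', hH'⟩ hlt
    have e0 : M' cell_n = n := by rw [hf cell_n (by decide)]; simp [hM.hn]
    have e1 : M' cell_k = k := by rw [hf cell_k (by decide)]; simp [hM.hk]
    have e3 : M' cell_Z = sketchBase p k := by rw [hf cell_Z (by decide)]; simp [hM.hZ]
    have e4 : M' cell_Q = p * p := by rw [hf cell_Q (by decide)]; simp [hM.hQ]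
    have hlt : M' cell_j < k := by
      by_contra hc
      exact hlt (by simp [e1]; omega)
    have hslot : M' cell_restS % sketchBase p k = slot p k (M cell_S) (M' cell_j) := by
      rw [hS', slot]
    -- The partial sums are dominated by the complete ones, whose bounds are known.
    have hsub : range (M' cell_j + 1) ⊆ range k := range_subset_range.2 hlt
    refine WP.seq (WP.imp (P := fun M₁ =>
      M₁ cell_heavyH = (∑ i ∈ range (M' cell_j + 1), if Heavy p k (M cell_S) i then
        M cell_H / n ^ i % n * n ^ Nat.count (Heavy p k (M cell_S)) i else 0) ∧
      M₁ cell_heavyS = (∑ i ∈ range (M' cell_j + 1), if Heavy p k (M cell_S) i then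
        slot p k (M cell_S) i * sketchBase p k ^ Nat.count (Heavy p k (M cell_S)) i else 0) ∧
      M₁ cell_lightS = (∑ i ∈ range (M' cell_j + 1), if Heavy p k (M cell_S) i then 0 else
        slot p k (M cell_S) i * sketchBase p k ^ i) ∧
      M₁ cell_pn = n ^ Nat.count (Heavy p k (M cell_S)) (M' cell_j + 1) ∧
      M₁ cell_pz = sketchBase p k ^ Nat.count (Heavy p k (M cell_S)) (M' cell_j + 1))
      (WP.ite (fun hh => ?_) fun hh => ?_) ?_)
    · have hh : Heavy p k (M cell_S) (M' cell_j) := by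
        by_contra hc
        apply hh
        simp [e1, e3, e4, hslot]
        simpa [Heavy] using hc
      have c1 : M' cell_heavyH + M' cell_restH % n * M' cell_pn =
          ∑ i ∈ range (M' cell_j + 1), if Heavy p k (M cell_S) i then
            M cell_H / n ^ i % n * n ^ Nat.count (Heavy p k (M cell_S)) i else 0 := by
        rw [sum_range_succ, if_pos hh, ← hhH, ← hpn, ← hH']
      have c2 : M' cell_heavyS + slot p k (M cell_S) (M' cell_j) * M' cell_pz =
          ∑ i ∈ range (M' cell_j + 1), if Heavy p k (M cell_S) i then
            slot p k (M cell_S) i * sketchBase p k ^ Nat.count (Heavy p k (M cell_S)) i else 0 := by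
        rw [sum_range_succ, if_pos hh, ← hhS, ← hpz]
      have c3 : Nat.count (Heavy p k (M cell_S)) (M' cell_j + 1) =
          Nat.count (Heavy p k (M cell_S)) (M' cell_j) + 1 := by
        rw [Nat.count_succ, if_pos hh]
      have c4 : M' cell_pn * n = n ^ Nat.count (Heavy p k (M cell_S)) (M' cell_j + 1) := by
        rw [c3, pow_succ, hpn]
      have c5 : M' cell_pz * sketchBase p k =
          sketchBase p k ^ Nat.count (Heavy p k (M cell_S)) (M' cell_j + 1) := by
        rw [c3, pow_succ, hpz]
      have hc1 := hcnt (M' cell_j + 1)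
      refine WP.put_seq ?_ (WP.put_seq ?_ (WP.put_seq ?_ (WP.put ?_ ?_)))
      · simp only [Expr.val_add, Expr.val_mul, Expr.val_mod, Expr.val_reg, e0, c1]
        refine (sum_le_sum_of_subset hsub).trans_lt
          ((heavyVertices_lt hn k p (M cell_H) (M cell_S)).trans ?_)
        exact hP.pow_n_lt' (heavyCount_le _ _ _)
      · simp [e3, hslot, c2]
        refine (sum_le_sum_of_subset hsub).trans_lt
          ((heavySlots_lt hP.prime.pos k (M cell_S)).trans ?_)
        exact hP.lt_of_le_pow le_rfl (by have := heavyCount_le k p (M cell_S); omega)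
      · simp [e0, c4]
        exact hP.pow_n_lt' (by omega)
      · simp [e3, c5]
        exact hP.lt_of_le_pow le_rfl (by omega)
      · simp [e0, e3, hslot, c1, c2, c4, c5]
        rw [sum_range_succ, if_pos hh, add_zero, hlS]
    · have hh : ¬ Heavy p k (M cell_S) (M' cell_j) := by
        intro hc
        simp only [Heavy] at hc
        simp [e1, e3, e4, hslot] at hh
        omega
      have c1 : M' cell_lightS + slot p k (M cell_S) (M' cell_j) * M' cell_qz =
          ∑ i ∈ range (M' cell_j + 1), if Heavy p k (M cell_S) i then 0 else
            slot p k (M cell_S) i * sketchBase p k ^ i := by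
        rw [sum_range_succ, if_neg hh, ← hlS, ← hqz]
      refine WP.put ?_ ?_
      · simp [e3, hslot, c1]
        refine (sum_le_sum_of_subset hsub).trans_lt
          ((lightSlots_lt hP.prime.pos k (M cell_S)).trans ?_)
        exact hP.lt_of_le_pow le_rfl (by omega)
      · simp [e3, hslot, c1, hpn, hpz]
        rw [sum_range_succ, if_neg hh, add_zero, hhH, sum_range_succ, if_neg hh, add_zero, hhS,
          Nat.count_succ, if_neg hh, add_zero]
        exact ⟨rfl, rfl, rfl, rfl⟩
    · rintro M₁ hf₁ ⟨g1, g2, g3, g4, g5⟩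
      have a0 : M₁ cell_n = n := by rw [hf₁ _ (by decide), e0]
      have a1 : M₁ cell_Z = sketchBase p k := by rw [hf₁ _ (by decide), e3]
      have a2 : M₁ cell_qz = sketchBase p k ^ M' cell_j := by rw [hf₁ _ (by decide), hqz]
      have a3 : M₁ cell_restS = M cell_S / sketchBase p k ^ M' cell_j := by
        rw [hf₁ _ (by decide), hS']
      have a4 : M₁ cell_restH = M cell_H / n ^ M' cell_j := by rw [hf₁ _ (by decide), hH']
      have a5 : M₁ cell_j = M' cell_j := by rw [hf₁ _ (by decide)]
      refine WP.put_seq ?_ (WP.put_seq ?_ (WP.put_seq ?_ (WP.put ?_ ?_)))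
      · simp [a1, a2, ← pow_succ]
        exact hP.lt_of_le_pow le_rfl (by omega)
      · simp [a3]
        exact ((Nat.div_le_self _ _).trans (Nat.div_le_self _ _)).trans_lt hS
      · simp [a4]
        exact ((Nat.div_le_self _ _).trans (Nat.div_le_self _ _)).trans_lt hH
      · simp [a5]
        exact hP.lt_of_le_p (by omega)
      · simp [a0, a1, a2, a3, a4, a5, g1, g2, g3, g4, g5, ← pow_succ, Nat.div_div_eq_div_mul]
        omega
  · rintro M' hf ⟨hj, hhH, hhS, hlS, hpn, -⟩ hge
    have e1 : M' cell_k = k := by rw [hf cell_k (by decide)]; simp [hM.hk]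
    have : M' cell_j = k := by
      simp [e1] at hge
      omega
    rw [this] at hhH hhS hlS hpn
    exact ⟨hhH, hhS, hlS, hpn⟩

/-- Since `Y` solves the equation, counting upwards stops at `Y` or earlier; this gives both the
variant and the bound on the counter. The value found may differ from `Y`; its identification with
the light edges is left to `Represents.eq_lightEdges`. -/
theorem decodeCmd_spec {n k p B : ℕ} (hP : Params n k p B) {M : ℕ →₀ ℕ} (hM : Ready n k p M)
    (hH : M cell_H < 2 ^ B) {Y : ℕ} (hY : Y < (n * n) ^ (k * k))
    (heq : loadSum n k p (M cell_H) (edgesOf n Y) = M cell_lightS) :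
    WP B decodeCmd (fun M' => M' cell_Y ≤ Y ∧
      loadSum n k p (M cell_H) (edgesOf n (M' cell_Y)) = M cell_lightS) M := by
  have h0 := hP.lt_of_le_p (x := 0) (by omega)
  have hn : 2 ≤ n := hP.two_le
  have hY' : (n * n) ^ (k * k) ≤ (n * n) ^ (k * k + 1) :=
    Nat.pow_le_pow_right (by positivity) (by omega)
  have hYB : Y < 2 ^ B := hP.lt_of_le_list (hY.le.trans hY')
  unfold decodeCmd
  refine WP.put_seq h0 (WP.put_seq (by simpa) (WP.seq ?_))
  refine (loadCmd_spec hP (hM.of_eq (by simp) (by simp) (by simp) (by simp) (by simp) (by simp)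
    (by simp)) (by simpa) (by simp; omega)).imp fun M₁ hf₁ hacc => ?_
  have b0 : M₁ cell_Y = 0 := by rw [hf₁ _ (by decide)]; simp
  have b1 : M₁ cell_G = M cell_H := by rw [hf₁ _ (by decide)]; simp
  have b2 : M₁ cell_lightS = M cell_lightS := by rw [hf₁ _ (by decide)]; simp
  have hR1 : Ready n k p M₁ := by
    refine hM.of_eq ?_ ?_ ?_ ?_ ?_ ?_ ?_ <;> (rw [hf₁ _ (by decide)]; simp)
  simp at hacc
  refine WP.loop (P := fun M' => M' cell_Y ≤ Y ∧
      M' cell_acc = loadSum n k p (M cell_H) (edgesOf n (M' cell_Y)))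
    (fun M' => Y - M' cell_Y) ?_ ?_ ?_
  · rw [b0]
    exact ⟨Nat.zero_le _, hacc⟩
  · rintro M' hf ⟨hle, ha⟩ hne
    have e1 : M' cell_G = M cell_H := by rw [hf _ (by decide), b1]
    have e2 : M' cell_lightS = M cell_lightS := by rw [hf _ (by decide), b2]
    have hne : M' cell_Y ≠ Y := by
      intro hc
      apply hne
      simp [e2, ha, hc, heq]
    have hR : Ready n k p M' := by
      refine hR1.of_eq ?_ ?_ ?_ ?_ ?_ ?_ ?_ <;> exact hf _ (by decide)
    refine WP.put_seq (by simp; omega) ?_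
    refine (loadCmd_spec hP (hR.of_eq (by simp) (by simp) (by simp) (by simp) (by simp) (by simp)
      (by simp)) (by simpa [e1]) (by simp; omega)).imp fun M₂ hf₂ hacc₂ => ?_
    have d0 : M₂ cell_Y = M' cell_Y + 1 := by rw [hf₂ _ (by decide)]; simp
    simp [e1] at hacc₂
    rw [d0]
    exact ⟨⟨by omega, hacc₂⟩, by omega⟩
  · rintro M' hf ⟨hle, ha⟩ hz
    have e2 : M' cell_lightS = M cell_lightS := by rw [hf _ (by decide), b2]
    refine ⟨hle, ?_⟩
    by_contra hc
    rw [← ha, ← e2] at hc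
    simp [hc] at hz

/-- A known solution `X` stops the search, as in `decodeCmd_spec`. The extension found is arbitrary,
but its load is below `sketchBase p k ^ k`, which is all that `Represents.rebuild` asks for. -/
theorem coverCmd_spec {n k p B : ℕ} (hP : Params n k p B) {M : ℕ →₀ ℕ} (hM : Ready n k p M)
    (hY : M cell_Y < (n * n) ^ (k * k + 1)) (hH : M cell_heavyH < n ^ k) (hpn : M cell_pn ≤ n ^ k)
    {X : ℕ} (hX : X < n ^ k)
    (hlt : loadSum n k p (M cell_heavyH + X * M cell_pn) (edgesOf n (M cell_Y)) <
      sketchBase p k ^ k) :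
    WP B coverCmd (fun M' => ∃ X', M' cell_G = M cell_heavyH + X' * M cell_pn ∧
      M' cell_G < 2 ^ B ∧
      M' cell_acc = loadSum n k p (M' cell_G) (edgesOf n (M cell_Y)) ∧
      M' cell_acc < sketchBase p k ^ k) M := by
  have h0 := hP.lt_of_le_p (x := 0) (by omega)
  have hbd : ∀ X' ≤ X, M cell_heavyH + X' * M cell_pn < 2 ^ B := by
    intro X' hX'
    refine hP.pow_n_lt ?_
    have h1 : X' * M cell_pn ≤ n ^ k * n ^ k := Nat.mul_le_mul (by omega) hpn
    have h2 : n ^ k * n ^ k = n ^ (2 * k) := by rw [← pow_add]; congr 1; omega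
    have h3 : n ^ k ≤ n ^ (2 * k) :=
      Nat.pow_le_pow_right (by have := hP.two_le; omega) (by omega)
    omega
  unfold coverCmd
  have hb0 := hbd 0 (by omega)
  rw [zero_mul, add_zero] at hb0
  refine WP.put_seq h0 (WP.put_seq (by simpa) (WP.seq ?_))
  refine (loadCmd_spec hP (hM.of_eq (by simp) (by simp) (by simp) (by simp) (by simp) (by simp)
    (by simp)) (by simpa) (by simpa)).imp fun M₁ hf₁ hacc => ?_
  have b0 : M₁ cell_X = 0 := by rw [hf₁ _ (by decide)]; simp
  have b1 : M₁ cell_G = M cell_heavyH := by rw [hf₁ _ (by decide)]; simp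
  have b2 : M₁ cell_heavyH = M cell_heavyH := by rw [hf₁ _ (by decide)]; simp
  have b3 : M₁ cell_pn = M cell_pn := by rw [hf₁ _ (by decide)]; simp
  have b4 : M₁ cell_Y = M cell_Y := by rw [hf₁ _ (by decide)]; simp
  have hR1 : Ready n k p M₁ := by
    refine hM.of_eq ?_ ?_ ?_ ?_ ?_ ?_ ?_ <;> (rw [hf₁ _ (by decide)]; simp)
  simp at hacc
  refine WP.loop (P := fun M' => M' cell_X ≤ X ∧
      M' cell_G = M cell_heavyH + M' cell_X * M cell_pn ∧
      M' cell_acc = loadSum n k p (M' cell_G) (edgesOf n (M cell_Y)))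
    (fun M' => X - M' cell_X) ?_ ?_ ?_
  · rw [b0, b1, hacc]
    simp
  · rintro M' hf ⟨hle, hG, ha⟩ hne
    have hR : Ready n k p M' := by
      refine hR1.of_eq ?_ ?_ ?_ ?_ ?_ ?_ ?_ <;> exact hf _ (by decide)
    have e2 : M' cell_heavyH = M cell_heavyH := by rw [hf _ (by decide), b2]
    have e3 : M' cell_pn = M cell_pn := by rw [hf _ (by decide), b3]
    have e4 : M' cell_Y = M cell_Y := by rw [hf _ (by decide), b4]
    have hne : M' cell_X ≠ X := by
      intro hc
      apply hne
      rw [hc] at hG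
      rw [← hG, ← ha] at hlt
      simp [hR.hZk, hlt]
    have hXn : X < 2 ^ B := hX.trans (hP.pow_n_lt' le_rfl)
    refine WP.put_seq (by simp; omega) (WP.put_seq ?_ ?_)
    · simp [e2, e3]
      exact hbd _ (by omega)
    refine (loadCmd_spec hP (hR.of_eq (by simp) (by simp) (by simp) (by simp) (by simp) (by simp)
      (by simp)) (by simpa [e2, e3] using hbd (M' cell_X + 1) (by omega))
      (by simpa [e4])).imp fun M₂ hf₂ hacc₂ => ?_
    have d0 : M₂ cell_X = M' cell_X + 1 := by rw [hf₂ _ (by decide)]; simp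
    have d1 : M₂ cell_G = M cell_heavyH + (M' cell_X + 1) * M cell_pn := by
      rw [hf₂ _ (by decide)]; simp [e2, e3]
    simp [e2, e3, e4] at hacc₂
    rw [d0, d1]
    exact ⟨⟨by omega, rfl, hacc₂⟩, by omega⟩
  · rintro M' hf ⟨hle, hG, ha⟩ hz
    have e5 : M' cell_Zk = sketchBase p k ^ k := by rw [hf _ (by decide), hR1.hZk]
    refine ⟨M' cell_X, hG, hG ▸ hbd _ hle, ha, ?_⟩
    by_contra hc
    simp [e5, hc] at hz

theorem edgesOf_single {n e : ℕ} (he : 0 < e) (hen : e < n * n) : edgesOf n e = {e} := by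
  rw [edgesOf, Nat.digits_of_lt _ _ he.ne' hen]
  rfl

theorem edgesOf_mul_add {n Y e : ℕ} (hn : 2 ≤ n) (he : 0 < e) (hen : e < n * n) :
    edgesOf n (Y * (n * n) + e) = e ::ₘ edgesOf n Y := by
  rw [edgesOf_of_ne_zero hn (by omega), mul_comm, Nat.mul_add_mod, Nat.mod_eq_of_lt hen,
    Nat.mul_add_div (by positivity), Nat.div_eq_of_lt hen, add_zero]

/-- Positivity matters: `Nat.digits` has no leading zeros, so a list ending in the code `0` would be
truncated. Codes of edges are positive because the larger end is. -/
theorem exists_edgesOf_eq {n : ℕ} (hn : 2 ≤ n) (E : Finset ℕ) (hE : ∀ e ∈ E, 0 < e ∧ e < n * n) :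
    ∃ Y < (n * n) ^ #E, edgesOf n Y = E.val := by
  have hb : 1 < n * n := by nlinarith
  refine ⟨Nat.ofDigits (n * n) E.toList, ?_, ?_⟩
  · rw [← E.length_toList]
    exact Nat.ofDigits_lt_base_pow_length hb fun e he => (hE e (mem_toList.1 he)).2
  · rw [edgesOf, Nat.digits_ofDigits _ hb _ fun e he => (hE e (mem_toList.1 he)).2]
    · simp
    · intro h
      exact (hE _ (mem_toList.1 (List.getLast_mem h))).1.ne'

/-! ### Processing an update -/

/-- The code of the edge with ends `u` and `v`. -/
def edgeCode (n u v : ℕ) : ℕ := min u v * n + max u v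

section edgeCode

variable {n u v : ℕ}

theorem edgeCode_div (hu : u < n) (hv : v < n) : edgeCode n u v / n = min u v := by
  rw [edgeCode, mul_comm, Nat.mul_add_div (by omega), Nat.div_eq_of_lt (max_lt hu hv), add_zero]

theorem edgeCode_mod (hu : u < n) (hv : v < n) : edgeCode n u v % n = max u v := by
  rw [edgeCode, mul_comm, Nat.mul_add_mod, Nat.mod_eq_of_lt (max_lt hu hv)]

theorem edgeCode_lt (hu : u < n) (hv : v < n) : edgeCode n u v < n * n := by
  have h1 : min u v + 1 ≤ n := Nat.succ_le_of_lt (min_lt_of_left_lt hu)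
  have h2 : max u v < n := max_lt hu hv
  unfold edgeCode
  nlinarith

theorem edgeCode_pos (huv : u ≠ v) : 0 < edgeCode n u v := by
  have : 0 < max u v := by
    rcases Nat.eq_zero_or_pos u with h | h
    · exact lt_max_of_lt_right (by omega)
    · exact lt_max_of_lt_left h
  unfold edgeCode
  omega

theorem edgeCode_comm : edgeCode n u v = edgeCode n v u := by
  rw [edgeCode, edgeCode, min_comm, max_comm]

end edgeCode

/-- The set `E` consists of codes of edges. -/
def IsCodes (n : ℕ) (E : Finset ℕ) : Prop := ∀ e ∈ E, e < n * n ∧ e / n < e % n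

theorem IsCodes.card_le {n : ℕ} {E : Finset ℕ} (h : IsCodes n E) : #E ≤ n * n := by
  simpa using card_le_card (t := range (n * n)) fun e he => mem_range.2 (h e he).1

theorem IsCodes.pos {n e : ℕ} {E : Finset ℕ} (h : IsCodes n E) (he : e ∈ E) : 0 < e := by
  have := (h e he).2
  rcases Nat.eq_zero_or_pos e with rfl | h
  · simp at this
  · exact h

/-- The update `(b, u, v)` turns the set `E` of edges into `E'`, which has a small vertex cover if
the edge is inserted. -/
def Transition (n k b u v : ℕ) (E E' : Finset ℕ) : Prop :=
  (b = 1 ∧ edgeCode n u v ∉ E ∧ E' = insert (edgeCode n u v) E ∧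
    ∃ T : Finset ℕ, #T ≤ k ∧ (∀ t ∈ T, t < n) ∧ ∀ e ∈ E', e / n ∈ T ∨ e % n ∈ T) ∨
  (b = 0 ∧ edgeCode n u v ∈ E ∧ E' = E.erase (edgeCode n u v))

theorem Represents.lt_two_pow {n k p B : ℕ} (hP : Params n k p B) {E : Finset ℕ} {H S : ℕ}
    (hE : #E ≤ p) (h : Represents n k p E H S) : S < 2 ^ B := by
  refine hP.lt_of_le_pow (j := k) ?_ (by omega)
  rw [h.eq_loadSum]
  exact (loadSum_lt_of_forall hP.prime.pos hE h.firstHit_lt).le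

theorem rebuildCmd_spec {n k p B : ℕ} (hP : Params n k p B) {M : ℕ →₀ ℕ} (hM : Ready n k p M)
    {E : Finset ℕ} (hE : IsCodes n E) (hrep : Represents n k p E (M cell_H) (M cell_S))
    (hH : M cell_H < 2 ^ B) (hS : M cell_S < 2 ^ B) (he0 : 0 < M cell_edge)
    (hen : M cell_edge < n * n) (heE : M cell_edge ∉ E) {T : Finset ℕ} (hT : #T ≤ k)
    (hTn : ∀ t ∈ T, t < n) (hcov : ∀ e ∈ insert (M cell_edge) E, e / n ∈ T ∨ e % n ∈ T) :
    WP B rebuildCmd (fun M' => Ready n k p M' ∧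
      Represents n k p (insert (M cell_edge) E) (M' cell_H) (M' cell_S)) M := by
  have hn := hP.two_le
  have hn0 : 0 < n := by omega
  have hp := hP.one_lt_p
  have hnnp : n * n < p := by have := hP.le_p; omega
  have hEp : #E ≤ p := hE.card_le.trans hnnp.le
  set e := M cell_edge with he
  unfold rebuildCmd
  refine WP.seq ((separateCmd_spec hP hM hH hS).imp
    fun M₂ hf₂ hsep => WP.seq ?_)
  obtain ⟨s1, s2, s3, s4⟩ := hsep
  have hR2 : Ready n k p M₂ := by
    refine hM.of_eq ?_ ?_ ?_ ?_ ?_ ?_ ?_ <;> exact hf₂ _ (by decide)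
  have cH : M₂ cell_H = M cell_H := hf₂ _ (by decide)
  have cE : M₂ cell_edge = e := hf₂ _ (by decide)
  have hLsub : lightEdges n k p E (M cell_H) (M cell_S) ⊆ E := filter_subset _ _
  obtain ⟨Y, hY, hYe⟩ := exists_edgesOf_eq hn (lightEdges n k p E (M cell_H) (M cell_S))
    fun a ha => ⟨hE.pos (hLsub ha), (hE a (hLsub ha)).1⟩
  have hYk : Y < (n * n) ^ (k * k) :=
    hY.trans_le (Nat.pow_le_pow_right (by positivity) (hrep.card_lightEdges_le hp hEp))
  refine (decodeCmd_spec hP hR2 (by rwa [cH]) hYk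
    (by rw [cH, s3, hYe, hrep.lightSlots_eq hp hEp])).imp fun M₃ hf₃ hdec => ?_
  obtain ⟨hY3, hdec⟩ := hdec
  rw [cH, s3] at hdec
  have hR3 : Ready n k p M₃ := by
    refine hR2.of_eq ?_ ?_ ?_ ?_ ?_ ?_ ?_ <;> exact hf₃ _ (by decide)
  have hY3k : M₃ cell_Y < (n * n) ^ (k * k) := by omega
  -- The search returns some list with the right sketches. Its entries are below `p` and there are
  -- at most `k * k < p` of them, so unique decoding applies.
  have hedges : edgesOf n (M₃ cell_Y) = (lightEdges n k p E (M cell_H) (M cell_S)).val := by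
    refine hrep.eq_lightEdges hP.prime hP.k_lt_p hEp (fun a ha => (hE a ha).1.trans hnnp) ?_ ?_ hdec
    · intro a ha
      have hb : 1 < n * n := Nat.one_lt_mul_iff.2 ⟨hn0, hn0, Or.inl hn⟩
      exact (Nat.digits_lt_base hb (Multiset.mem_coe.1 ha)).trans hnnp
    · have := card_edgesOf_le hn hY3k
      have := hP.sq_lt_p
      omega
  have d1 : M₃ cell_heavyH = M₂ cell_heavyH := hf₃ _ (by decide)
  have d2 : M₃ cell_heavyS = M₂ cell_heavyS := hf₃ _ (by decide)
  have d3 : M₃ cell_pn = M₂ cell_pn := hf₃ _ (by decide)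
  have dE : M₃ cell_edge = e := by rw [hf₃ _ (by decide), cE]
  have hYnew : M₃ cell_Y * (n * n) + e < (n * n) ^ (k * k + 1) := by
    have : (M₃ cell_Y + 1) * (n * n) ≤ (n * n) ^ (k * k) * (n * n) :=
      Nat.mul_le_mul_right _ hY3k
    rw [add_mul, one_mul] at this
    rw [pow_succ]
    omega
  refine WP.put_seq ?_ (WP.seq ?_)
  · simp only [Expr.val_add, Expr.val_mul, Expr.val_reg, hR3.hN, dE]
    exact hP.lt_of_le_list hYnew.le
  obtain ⟨X, hX, hXlt⟩ := hrep.exists_rebuild hn0 hp hEp (by have := hP.sq_lt_p; omega)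
    (fun a ha => (hE a ha).2) hT hTn hcov
  have hcard := heavyCount_le k p (M cell_S)
  have hpnk : n ^ heavyCount k p (M cell_S) ≤ n ^ k := Nat.pow_le_pow_right hn0 hcard
  have hcover := coverCmd_spec (X := X) hP (M := M₃.update cell_Y
      ((Expr.reg cell_Y * Expr.reg cell_N + Expr.reg cell_edge).val M₃))
    (hR3.of_eq (by simp) (by simp) (by simp) (by simp) (by simp) (by simp) (by simp))
    (by simpa [hR3.hN, dE] using hYnew)
    (by simpa [d1, s1] using (heavyVertices_lt hn0 _ _ _ _).trans_le hpnk)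
    (by simpa [d3, s4] using hpnk) hX
    (by simpa [hR3.hN, dE, d1, d3, s1, s4, edgesOf_mul_add hn he0 hen, hedges] using hXlt)
  refine hcover.imp fun M₄ hf₄ ⟨X', hG, hGB, ha, halt⟩ => ?_
  simp [hR3.hN, dE, d1, d3, s1, s4, edgesOf_mul_add hn he0 hen, hedges] at hG ha
  have f1 : M₄ cell_heavyS = heavySlots k p (M cell_S) := by
    rw [hf₄ _ (by decide)]; simp [d2, s2]
  rw [hG] at ha
  rw [ha] at halt
  have hnew := hrep.rebuild hn0 hp hEp heE X' halt
  have hcard : #(insert e E) ≤ p := by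
    have := card_insert_le e E
    have := hE.card_le
    omega
  have hR4 : Ready n k p M₄ := by
    refine hR3.of_eq ?_ ?_ ?_ ?_ ?_ ?_ ?_ <;> (rw [hf₄ _ (by decide)]; simp)
  refine WP.put_seq ?_ (WP.put ?_ ⟨?_, ?_⟩)
  · simp only [Expr.val_add, Expr.val_reg, f1, ha]
    exact hnew.lt_two_pow hP hcard
  · simpa using hGB
  · refine hR4.of_eq ?_ ?_ ?_ ?_ ?_ ?_ ?_ <;> simp
  · simpa [f1, ha, hG] using hnew

/-- If the edge is covered by `H`, linearity of the sketches settles both kinds of updates. An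
uncovered edge is not in `E`, hence it is being inserted and the promised cover is available for
`rebuildCmd`. -/
theorem updateCmd_spec {n k p B : ℕ} (hP : Params n k p B) {M : ℕ →₀ ℕ} (hM : Ready n k p M)
    {E E' : Finset ℕ} (hE : IsCodes n E) (hrep : Represents n k p E (M cell_H) (M cell_S))
    (hH : M cell_H < 2 ^ B) (hS : M cell_S < 2 ^ B) (hu : M cell_u < n) (hv : M cell_v < n)
    (huv : M cell_u ≠ M cell_v)
    (htr : Transition n k (M cell_ins) (M cell_u) (M cell_v) E E') :
    WP B updateCmd
      (fun M' => Ready n k p M' ∧ Represents n k p E' (M' cell_H) (M' cell_S)) M := by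
  have hn := hP.two_le
  have hn0 : 0 < n := by omega
  have hp := hP.one_lt_p
  set e := edgeCode n (M cell_u) (M cell_v) with he
  have he0 : 0 < e := edgeCode_pos huv
  have hen : e < n * n := edgeCode_lt hu hv
  have hnnp : n * n < p := by have := hP.le_p; omega
  have hEp : #E ≤ p := hE.card_le.trans hnnp.le
  have hexp : (Expr.op .lt (Expr.reg cell_u) (Expr.reg cell_v) *
      (Expr.reg cell_u * Expr.reg cell_n + Expr.reg cell_v) +
      Expr.op .lt (Expr.reg cell_v) (Expr.reg cell_u) *
      (Expr.reg cell_v * Expr.reg cell_n + Expr.reg cell_u)).val M = e := by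
    simp only [Expr.val_add, Expr.val_mul, Expr.val_lt, Expr.val_reg, hM.hn, he, edgeCode]
    rcases lt_or_gt_of_ne huv with h | h
    · simp [h, h.not_gt, h.le]
    · simp [h, h.not_gt, h.le]
  unfold updateCmd
  refine WP.put_seq (by rw [hexp]; exact hP.lt_of_le_p (by omega)) ?_
  rw [hexp]
  refine WP.put_seq (by simpa using hP.lt_of_le_p (by omega)) (WP.put_seq (by simpa) (WP.seq ?_))
  have hpow : n * n ≤ (n * n) ^ (k * k + 1) := Nat.le_self_pow (by omega) _
  refine (loadCmd_spec hP (hM.of_eq (by simp) (by simp) (by simp) (by simp) (by simp) (by simp)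
    (by simp)) (by simpa) (by simp; omega)).imp fun M₁ hf₁ hacc => ?_
  have hR1 : Ready n k p M₁ := by
    refine hM.of_eq ?_ ?_ ?_ ?_ ?_ ?_ ?_ <;> (rw [hf₁ _ (by decide)]; simp)
  have bH : M₁ cell_H = M cell_H := by rw [hf₁ _ (by decide)]; simp
  have bS : M₁ cell_S = M cell_S := by rw [hf₁ _ (by decide)]; simp
  have bI : M₁ cell_ins = M cell_ins := by rw [hf₁ _ (by decide)]; simp
  have bE : M₁ cell_edge = e := by rw [hf₁ _ (by decide)]; simp
  simp [edgesOf_single he0 hen] at hacc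
  refine WP.ite (fun hlt => ?_) fun hge => ?_
  · have hlt : loadSum n k p (M cell_H) {e} < sketchBase p k ^ k := by
      by_contra hc
      apply hlt
      simp only [Expr.val_lt, Expr.val_reg, hacc, hR1.hZk, if_neg hc]
    have hhit := forall_of_loadSum_lt hp hlt e (Multiset.mem_singleton_self e)
    refine WP.ite (fun hb => ?_) fun hb => ?_
    · have hb : M cell_ins ≠ 0 := by rw [← bI]; exact hb
      obtain ⟨-, heE, rfl, -⟩ | ⟨hb', -⟩ := htr
      swap
      · exact absurd hb' hb
      have hnew : Represents n k p (insert e E) (M cell_H) (M cell_S + M₁ cell_acc) := by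
        constructor
        · rw [insert_val_of_notMem heE, ← Multiset.singleton_add, loadSum_add, hacc,
            ← hrep.eq_loadSum, add_comm]
        · intro a ha
          rcases mem_insert.1 ha with rfl | ha
          · exact hhit
          · exact hrep.firstHit_lt a ha
      have hcard : #(insert e E) ≤ p := by
        have := card_insert_le e E
        have := hE.card_le
        omega
      refine WP.put (by simpa [bS] using hnew.lt_two_pow hP hcard) ⟨?_, by simpa [bS, bH] using hnew⟩
      refine hR1.of_eq ?_ ?_ ?_ ?_ ?_ ?_ ?_ <;> simp
    · have hb : M cell_ins = 0 := by rw [← bI]; exact hb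
      obtain ⟨hb', -⟩ | ⟨-, heE, rfl⟩ := htr
      · omega
      have hnew : Represents n k p (E.erase e) (M cell_H) (M cell_S - M₁ cell_acc) := by
        constructor
        -- The load of `e` is one of the summands of `S`, so the truncated subtraction is exact.
        · have hval : E.val = {e} + (E.erase e).val := by
            rw [erase_val, Multiset.singleton_add, Multiset.cons_erase heE]
          rw [hrep.eq_loadSum, hval, loadSum_add, hacc]
          omega
        · exact fun a ha => hrep.firstHit_lt a (mem_of_mem_erase ha)
      refine WP.put (by simpa [bS] using (Nat.sub_le _ _).trans_lt hS)
        ⟨?_, by simpa [bS, bH] using hnew⟩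
      refine hR1.of_eq ?_ ?_ ?_ ?_ ?_ ?_ ?_ <;> simp
  · have hge : ¬ firstHit n e k (M cell_H) < k := by
      intro hc
      have := loadSum_lt_of_forall (n := n) (k := k) (H := M cell_H) (by omega : 0 < p)
        (m := {e}) (by simp; omega) (by simpa using hc)
      rw [← hacc, ← hR1.hZk] at this
      simp [this] at hge
    obtain ⟨-, heE, rfl, T, hT, hTn, hcov⟩ | ⟨-, heE, rfl⟩ := htr
    swap
    · exact absurd (hrep.firstHit_lt e heE) hge
    refine (rebuildCmd_spec hP hR1 hE (by rwa [bH, bS]) (by rwa [bH]) (by rwa [bS])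
      (by rwa [bE]) (by rwa [bE]) (by rwa [bE]) hT hTn (by rwa [bE])).imp fun M₂ _ h => ?_
    rwa [bE] at h

/-! ### Initialization -/

open StreamRAM.Expr in
/-- Search for a prime, starting from the content of the cell `p`. -/
def primeCmd : Cmd :=
  cell_r ::= lit 2 ;;
  .loop (op .lt (reg cell_r) (reg cell_p))
    (.ite (reg cell_p % reg cell_r)
      (cell_r ::= reg cell_r + lit 1)
      (cell_p ::= reg cell_p + lit 1 ;; cell_r ::= lit 2))

open StreamRAM.Expr in
/-- Store in the cell `a` the power of the cell `b` whose exponent is the value of `l`. -/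
def powCmd (a b : ℕ) (l : Expr) : Cmd :=
  a ::= lit 1 ;; cell_i ::= lit 0 ;;
  .loop (op .lt (reg cell_i) l) (a ::= reg a * reg b ;; cell_i ::= reg cell_i + lit 1)

open StreamRAM.Expr in
/-- Compute the parameters of the algorithm. -/
def initCmd : Cmd :=
  .ite (op .lt (reg cell_n) (reg cell_k)) (cell_k ::= reg cell_n) .skip ;;
  cell_N ::= reg cell_n * reg cell_n ;;
  cell_p ::= reg cell_N + lit 2 ;;
  primeCmd ;;
  cell_Q ::= reg cell_p * reg cell_p ;;
  powCmd cell_Z cell_Q (reg cell_k + reg cell_k + lit 1) ;;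
  powCmd cell_Zk cell_Z (reg cell_k)

/-- Trial division of successive candidates; any prime `q` above the starting value bounds the
search. -/
theorem primeCmd_spec {B q : ℕ} {M : ℕ →₀ ℕ} (h2 : 2 ≤ M cell_p) (hq : q.Prime)
    (hpq : M cell_p ≤ q) (hqB : q < 2 ^ B) :
    WP B primeCmd (fun M' => (M' cell_p).Prime ∧ M cell_p ≤ M' cell_p ∧ M' cell_p ≤ q) M := by
  unfold primeCmd
  refine WP.put_seq (by simp; omega) ?_
  refine WP.loop (P := fun M' => M cell_p ≤ M' cell_p ∧ M' cell_p ≤ q ∧ 2 ≤ M' cell_r ∧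
      M' cell_r ≤ M' cell_p ∧ ∀ d, 2 ≤ d → d < M' cell_r → ¬ d ∣ M' cell_p)
    -- A lexicographic variant: passing to the next candidate saves `q + 1`, more than resetting the
    -- divisor to `2` can cost.
    (fun M' => (q - M' cell_p) * (q + 1) + (q - M' cell_r)) ?_ ?_ ?_
  · simp
    exact ⟨hpq, h2, fun d h h' => by omega⟩
  · rintro M' - ⟨h1, h3, h4, h5, h6⟩ hlt
    have hlt : M' cell_r < M' cell_p := (Expr.val_lt_ne_zero _ _ _).1 hlt
    refine WP.ite (fun hm => ?_) fun hm => ?_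
    · refine WP.put (by simp; omega) ?_
      simp
      refine ⟨⟨h1, h3, by omega, by omega, fun d hd hd' hdvd => ?_⟩, by omega⟩
      rcases Nat.lt_or_eq_of_le hd' with h | rfl
      · exact h6 d hd h hdvd
      · exact hm (Nat.mod_eq_zero_of_dvd hdvd)
    · have hm : M' cell_p % M' cell_r = 0 := hm
      have hne : M' cell_p ≠ q := by
        rintro rfl
        have := (Nat.dvd_prime hq).1 (Nat.dvd_of_mod_eq_zero hm)
        omega
      refine WP.put_seq (by simp; omega) (WP.put (by simp; omega) ?_)
      simp
      refine ⟨⟨by omega, by omega, by omega, fun d h h' => by omega⟩, ?_⟩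
      obtain ⟨a, ha⟩ : ∃ a, q - M' cell_p = a + 1 := ⟨q - M' cell_p - 1, by omega⟩
      have ha' : q - (M' cell_p + 1) = a := by omega
      rw [ha, ha', add_mul]
      omega
  · rintro M' - ⟨h1, h3, h4, h5, h6⟩ hge
    have heq : M' cell_r = M' cell_p := le_antisymm h5 ((Expr.val_lt_eq_zero _ _ _).1 hge)
    refine ⟨?_, h1, h3⟩
    rw [heq] at h6
    exact Nat.prime_def_lt'.2 ⟨by omega, h6⟩

/-- The hypothesis `hl` says that the exponent is unaffected by the two cells that the loop changes.
-/
theorem powCmd_spec {B a b m : ℕ} {l : Expr} {M : ℕ →₀ ℕ} (hab : a ≠ b) (ha : a ≠ cell_i)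
    (hb : b ≠ cell_i) (hB : (M b) ^ m < 2 ^ B) (hm : m < 2 ^ B) (h1 : 1 < 2 ^ B)
    (hl : ∀ M', (∀ c, c ≠ a → c ≠ cell_i → M' c = M c) → l.val M' = m) (h0 : 0 < M b) :
    WP B (powCmd a b l) (fun M' => M' a = M b ^ m) M := by
  unfold powCmd
  refine WP.put_seq h1 (WP.put_seq (by simp) ?_)
  have hframe : ∀ M' : ℕ →₀ ℕ, (∀ c, (a ::= Expr.reg a * Expr.reg b ;;
      cell_i ::= Expr.reg cell_i + Expr.lit 1).keeps c = true →
      M' c = ((M.update a ((Expr.lit 1).val M)).update cell_i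
        ((Expr.lit 0).val (M.update a ((Expr.lit 1).val M)))) c) →
      ∀ c, c ≠ a → c ≠ cell_i → M' c = M c := by
    intro M' hf c h1 h2
    rw [hf c (by simp [Cmd.keeps, put, h1, h2])]
    simp [h1, h2]
  refine WP.loop (P := fun M' => M' cell_i ≤ m ∧ M' a = M b ^ M' cell_i)
    (fun M' => m - M' cell_i) ?_ ?_ ?_
  · simp [ha]
  · rintro M' hf ⟨hi, hpow⟩ hlt
    have hf' := hframe M' hf
    have hb' : M' b = M b := hf' b hab.symm hb
    have hlt : M' cell_i < m := by
      rw [Expr.val_lt_ne_zero, hl M' hf'] at hlt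
      exact hlt
    refine WP.put_seq ?_ (WP.put ?_ ?_)
    · simp [hb', hpow, ← pow_succ]
      exact (Nat.pow_le_pow_right h0 hlt).trans_lt hB
    · simp [ha.symm]
      omega
    · simp [ha, ha.symm, hb', hpow, ← pow_succ]
      omega
  · rintro M' hf ⟨hi, hpow⟩ hge
    have : M' cell_i = m := by
      rw [Expr.val_lt_eq_zero, hl M' (hframe M' hf)] at hge
      exact le_antisymm hi hge
    rw [hpow, this]

theorem initCmd_spec {n k₀ k B : ℕ} (hk : k = min k₀ n) (hn : 1 ≤ n) {M : ℕ →₀ ℕ}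
    (h0 : M cell_n = n) (h1 : M cell_k = k₀)
    (hB : sketchBase (2 * (n * n + 1)) k ^ (k + 3) < 2 ^ B) (hnB : n < 2 ^ B) :
    WP B initCmd (fun M' => ∃ p, Ready n k p M' ∧ p.Prime ∧ n * n + 2 ≤ p ∧
      sketchBase p k ^ (k + 3) < 2 ^ B) M := by
  -- Bertrand's postulate bounds the prime found by `2 * (n * n + 1)`, the value for which `hB`
  -- reserves space.
  obtain ⟨q, hq, hq1, hq2⟩ := Nat.exists_prime_lt_and_le_two_mul (n * n + 1) (by omega)
  have hmono : ∀ p, p ≤ 2 * (n * n + 1) → sketchBase p k ^ (k + 3) < 2 ^ B := by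
    intro p hp
    refine lt_of_le_of_lt ?_ hB
    unfold sketchBase
    gcongr
  have hsmall : ∀ p x, 2 ≤ p → p ≤ 2 * (n * n + 1) → ∀ j ≤ k + 3, x ≤ sketchBase p k ^ j →
      x < 2 ^ B := fun p x hp2 hp j hj hx =>
    (hx.trans (Nat.pow_le_pow_right (sketchBase_pos (by omega) k) hj)).trans_lt (hmono p hp)
  have hpp : ∀ p, 2 ≤ p → p * p ≤ sketchBase p k ^ 1 := by
    intro p hp
    rw [pow_one, sketchBase]
    exact Nat.le_self_pow (by omega) _
  have hple : ∀ p, p ≤ p * p := Nat.le_mul_self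
  have hnn : n ≤ n * n := Nat.le_mul_self n
  have h2n : 2 * n ≤ n * n + 1 := by
    obtain ⟨m, rfl⟩ : ∃ m, n = m + 1 := ⟨n - 1, by omega⟩
    nlinarith
  have hq2B : q < 2 ^ B :=
    hsmall q q hq.two_le hq2 1 (by omega) ((hple q).trans (hpp q hq.two_le))
  have hkn : k ≤ n := hk ▸ min_le_right _ _
  unfold initCmd
  refine WP.seq (WP.imp (P := fun M' => M' cell_k = k) (WP.ite (fun h => ?_) fun h => ?_) ?_)
  · refine WP.put (by simpa [h0]) ?_
    rw [Expr.val_lt_ne_zero, Expr.val_reg, Expr.val_reg, h0, h1] at h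
    simp [h0]
    omega
  · refine WP.skip ?_
    rw [Expr.val_lt_eq_zero, Expr.val_reg, Expr.val_reg, h0, h1] at h
    rw [h1]
    omega
  · intro M₁ hf₁ hk₁
    have hn₁ : M₁ cell_n = n := by rw [hf₁ _ (by decide), h0]
    refine WP.put_seq (by simp [hn₁]; omega) (WP.put_seq (by simp [hn₁]; omega) (WP.seq ?_))
    refine (primeCmd_spec (q := q) (by simp) hq (by simp [hn₁]; omega) hq2B).imp
      fun M₂ hf₂ ⟨hp, hp1, hp2⟩ => ?_
    simp [hn₁] at hp1
    have hn₂ : M₂ cell_n = n := by rw [hf₂ _ (by decide)]; simp [hn₁]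
    have hk₂ : M₂ cell_k = k := by rw [hf₂ _ (by decide)]; simp [hk₁]
    have hN₂ : M₂ cell_N = n * n := by rw [hf₂ _ (by decide)]; simp [hn₁]
    generalize hpe : M₂ cell_p = p at *
    have hpB := hsmall p _ hp.two_le (by omega) 1 (by omega) (hpp p hp.two_le)
    have hone : 1 < 2 ^ B := by have := hp.two_le; have := hple p; omega
    refine WP.put_seq (by simpa [hpe]) (WP.seq ?_)
    refine (powCmd_spec (m := 2 * k + 1) (by decide) (by decide) (by decide) ?_ ?_ hone ?_ ?_).imp
      fun M₃ hf₃ hZ => ?_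
    · simp [hpe]
      exact hsmall p _ hp.two_le (by omega) 1 (by omega) (by rw [pow_one, sketchBase])
    · have := hple p
      omega
    · intro M' hM'
      have := hM' cell_k (by decide) (by decide)
      simp [hk₂] at this
      simp [this]
      omega
    · simp [hpe]
      exact hp.ne_zero
    simp [hpe] at hZ
    have hk₃ : M₃ cell_k = k := by rw [hf₃ _ (by decide)]; simp [hk₂]
    refine (powCmd_spec (m := k) (by decide) (by decide) (by decide) ?_ ?_ hone ?_ ?_).imp
      fun M₄ hf₄ hZk => ?_
    · rw [hZ]
      exact hsmall p _ hp.two_le (by omega) k (by omega) le_rfl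
    · omega
    · intro M' hM'
      have := hM' cell_k (by decide) (by decide)
      simp [this, hk₃]
    · rw [hZ]
      exact sketchBase_pos hp.pos k
    refine ⟨p, ⟨?_, ?_, ?_, ?_, ?_, ?_, ?_⟩, hp, hp1, hmono p (by omega)⟩
    · rw [hf₄ _ (by decide), hf₃ _ (by decide)]; simp [hn₂]
    · rw [hf₄ _ (by decide), hk₃]
    · rw [hf₄ _ (by decide), hf₃ _ (by decide)]; simp [hN₂]
    · rw [hf₄ _ (by decide), hf₃ _ (by decide)]; simp [hpe]
    · rw [hf₄ _ (by decide), hf₃ _ (by decide)]; simp [hpe]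
    · rw [hf₄ _ (by decide), hZ, sketchBase]
    · rw [hZk, hZ, sketchBase]

/-! ### Extraction -/

open StreamRAM.Expr in
/-- The body of the loop that prints the list of vertices. -/
def printCmd : Cmd :=
  .emit (reg cell_H % reg cell_n) ;;
  cell_H ::= reg cell_H / reg cell_n ;;
  cell_i ::= reg cell_i + lit 1

open StreamRAM.Expr in
/-- Print the list of vertices. -/
def extractCmd : Cmd :=
  cell_i ::= lit 0 ;; .loop (op .lt (reg cell_i) (reg cell_k)) printCmd

theorem exec_put {ω : ℕ → Bool} {r B a w : ℕ} {e : Expr} {s : State} (hs : Bounded r B s.mem)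
    (ha : a < r) (he : e.val s.mem < 2 ^ B) (hw : (Expr.lit a).weight + e.weight ≤ w) :
    ∃ t, Exec ω (a ::= e) s t ∧ t.mem = s.mem.update a (e.val s.mem) ∧ t.out = s.out ∧
      Bounded r B t.mem ∧ t.time ≤ s.time + w * (B + 1) ∧
      t.peak ≤ max s.peak (spaceBound r B w) := by
  obtain ⟨t, h1, h2, h3, h4, h5⟩ := (Ev.assign a e s.mem he).reaches ω (w := w)
    ⟨a, ha, rfl⟩ hw hs s rfl
  refine ⟨t, h1, h2, h3, h2 ▸ h4, ?_, h5⟩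
  cases h1
  have g1 := (Expr.lit a).cost_le hs.1
  have g2 := e.cost_le hs.1
  have g3 : ((Expr.lit a).weight + e.weight) * (B + 1) ≤ w * (B + 1) := Nat.mul_le_mul_right _ hw
  rw [add_mul] at g3
  simp only [State.write, State.charge]
  omega

theorem exec_emit {ω : ℕ → Bool} {r B w : ℕ} {e : Expr} {s : State} (hs : Bounded r B s.mem)
    (hw : e.weight ≤ w) :
    ∃ t, Exec ω (.emit e) s t ∧ t.mem = s.mem ∧ t.out = s.out ++ [e.val s.mem] ∧
      t.time ≤ s.time + w * (B + 1) ∧ t.peak ≤ max s.peak (spaceBound r B w) := by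
  have g := (e.cost_le hs.1).trans (Nat.mul_le_mul_right _ hw)
  have g' := hs.memBits_le
  refine ⟨_, .emit e s, rfl, rfl, ?_, ?_⟩
  · simp only [State.print, State.charge]
    omega
  · simp only [State.print, State.charge, spaceBound]
    omega

/-- A bound for the weights of the expressions used in the extraction. -/
def extractWeight : ℕ := 100

/-- Printing lies outside `Ev`, and its time counts, so it is treated directly. A round costs four
units (test, output, two assignments), and the last test one more. -/
theorem print_loop {ω : ℕ → Bool} {B n l : ℕ} {s : State} (hs : Bounded 36 B s.mem)
    (hn : s.mem cell_n = n) (hl : s.mem cell_k = s.mem cell_i + l) :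
    ∃ t, Exec ω (.loop (.op .lt (.reg cell_i) (.reg cell_k)) printCmd) s t ∧
      t.out = s.out ++ (List.range l).map (fun i => s.mem cell_H / n ^ i % n) ∧
      t.time ≤ s.time + (4 * l + 1) * (extractWeight * (B + 1)) ∧
      t.peak ≤ max s.peak (spaceBound 36 B extractWeight) := by
  have hcost : (Expr.op .lt (.reg cell_i) (.reg cell_k)).cost s.mem ≤
      extractWeight * (B + 1) :=
    (Expr.cost_le hs.1 _).trans (Nat.mul_le_mul_right _ (by decide))
  have hbits := hs.memBits_le
  induction l generalizing s with
  | zero =>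
    refine ⟨_, .loop_false ((Expr.val_lt_eq_zero _ _ _).2 (by simp; omega)), by simp [State.charge], ?_, ?_⟩
    · simp only [State.charge]
      omega
    · simp only [State.charge, spaceBound]
      omega
  | succ l ih =>
    set c := (Expr.op .lt (.reg cell_i) (.reg cell_k)).cost s.mem with hc
    obtain ⟨s₁, x1, x2, x3, x4, x5⟩ := exec_emit (ω := ω) (r := 36) (w := extractWeight)
      (e := .reg cell_H % .reg cell_n) (s := s.charge c) hs (by decide)
    have hs₁ : Bounded 36 B s₁.mem := by rw [x2]; exact hs
    obtain ⟨s₂, y1, y2, y3, y6, y4, y5⟩ := exec_put (ω := ω) (a := cell_H) (w := extractWeight)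
      (e := .reg cell_H / .reg cell_n) hs₁ (by decide)
      (by simpa using (Nat.div_le_self _ _).trans_lt (hs₁.1 _)) (by decide)
    obtain ⟨s₃, z1, z2, z3, z6, z4, z5⟩ := exec_put (ω := ω) (a := cell_i) (w := extractWeight)
      (e := .reg cell_i + .lit 1) y6 (by decide) (by
        have := hs.1 cell_k
        simp [y2, x2, State.charge]
        omega) (by decide)
    have m1 : s₃.mem cell_n = n := by simp [z2, y2, x2, State.charge, hn]
    have m2 : s₃.mem cell_k = s₃.mem cell_i + l := by
      simp [z2, y2, x2, State.charge, hl]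
      omega
    have m3 : s₃.mem cell_H = s.mem cell_H / n := by simp [z2, y2, x2, State.charge, hn]
    obtain ⟨t, w1, w2, w3, w4⟩ := ih z6 m1 m2
      ((Expr.cost_le z6.1 _).trans (Nat.mul_le_mul_right _ (by decide))) z6.memBits_le
    refine ⟨t, .loop_true ((Expr.val_lt_ne_zero _ _ _).2 (by simp; omega)) (.seq x1 (.seq y1 z1)) w1, ?_, ?_, ?_⟩
    · rw [w2, z3, y3, x3, List.range_succ_eq_map, m3]
      simp [State.charge, hn, pow_succ', Nat.div_div_eq_div_mul, Function.comp_def]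
    · have : (s.charge c).time = s.time + c := rfl
      have e1 : (4 * (l + 1) + 1) * (extractWeight * (B + 1)) =
        (4 * l + 1) * (extractWeight * (B + 1)) + 4 * (extractWeight * (B + 1)) := by ring
      omega
    · have : (s.charge c).peak = max s.peak (memBits s.mem + c) := rfl
      have e1 : memBits s.mem + c ≤ spaceBound 36 B extractWeight := by
        unfold spaceBound
        omega
      omega

theorem extractCmd_spec {ω : ℕ → Bool} {B n k : ℕ} {s : State} (hs : Bounded 36 B s.mem)
    (hn : s.mem cell_n = n) (hk : s.mem cell_k = k) :
    ∃ t, Exec ω extractCmd s t ∧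
      t.out = s.out ++ (List.range k).map (fun i => s.mem cell_H / n ^ i % n) ∧
      t.time ≤ s.time + (4 * k + 2) * (extractWeight * (B + 1)) ∧
      t.peak ≤ max s.peak (spaceBound 36 B extractWeight) := by
  obtain ⟨s₁, y1, y2, y3, y6, y4, y5⟩ := exec_put (ω := ω) (a := cell_i) (w := extractWeight)
      (e := .lit 0) hs (by decide) (by simp) (by decide)
  obtain ⟨t, w1, w2, w3, w4⟩ := print_loop (ω := ω) (n := n) (l := k) y6 (by simp [y2, hn])
    (by simp [y2, hk])
  refine ⟨t, .seq y1 w1, ?_, ?_, ?_⟩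
  · rw [w2, y3]
    simp [y2]
  · have e1 : (4 * k + 2) * (extractWeight * (B + 1)) =
      (4 * k + 1) * (extractWeight * (B + 1)) + extractWeight * (B + 1) := by ring
    omega
  · omega

/-! ### The codes of the edges of a graph -/

open Classical in
/-- The codes of the edges of a graph. -/
noncomputable def codes {n : ℕ} (G : SimpleGraph (Fin n)) : Finset ℕ :=
  ((univ : Finset (Fin n × Fin n)).filter fun x => G.Adj x.1 x.2).image
    fun x => edgeCode n x.1 x.2

theorem mem_codes {n : ℕ} {G : SimpleGraph (Fin n)} {e : ℕ} :
    e ∈ codes G ↔ ∃ u v : Fin n, G.Adj u v ∧ edgeCode n u v = e := by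
  simp [codes]

theorem edgeCode_eq_iff {n : ℕ} {u v a b : Fin n} :
    edgeCode n u v = edgeCode n a b ↔ (u = a ∧ v = b) ∨ (u = b ∧ v = a) := by
  constructor
  · intro h
    have h1 := edgeCode_div u.2 v.2
    have h2 := edgeCode_mod u.2 v.2
    rw [h, edgeCode_div a.2 b.2] at h1
    rw [h, edgeCode_mod a.2 b.2] at h2
    simp only [Fin.ext_iff]
    omega
  · rintro (⟨rfl, rfl⟩ | ⟨rfl, rfl⟩)
    · rfl
    · exact edgeCode_comm

theorem edgeCode_mem_codes {n : ℕ} {G : SimpleGraph (Fin n)} {u v : Fin n} :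
    edgeCode n u v ∈ codes G ↔ G.Adj u v := by
  rw [mem_codes]
  constructor
  · rintro ⟨a, b, hab, h⟩
    rcases edgeCode_eq_iff.1 h with ⟨rfl, rfl⟩ | ⟨rfl, rfl⟩
    exacts [hab, hab.symm]
  · exact fun h => ⟨u, v, h, rfl⟩

theorem isCodes_codes {n : ℕ} (G : SimpleGraph (Fin n)) : IsCodes n (codes G) := by
  intro e he
  obtain ⟨u, v, huv, rfl⟩ := mem_codes.1 he
  refine ⟨edgeCode_lt u.2 v.2, ?_⟩
  rw [edgeCode_div u.2 v.2, edgeCode_mod u.2 v.2, min_lt_max]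
  exact fun h => huv.ne (Fin.ext h)

theorem codes_apply_ins {n : ℕ} (G : SimpleGraph (Fin n)) {x : EdgeUpdate n}
    (hx : x.ins = true) : codes (x.apply G) = insert (edgeCode n x.u x.v) (codes G) := by
  ext e
  rw [mem_insert, mem_codes, mem_codes, EdgeUpdate.apply, if_pos hx]
  constructor
  · rintro ⟨a, b, hab, rfl⟩
    rw [SimpleGraph.sup_adj, SimpleGraph.edge_adj] at hab
    rcases hab with hab | ⟨hab, -⟩
    · exact Or.inr ⟨a, b, hab, rfl⟩
    · exact Or.inl (edgeCode_eq_iff.2 hab)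
  · rintro (rfl | ⟨a, b, hab, rfl⟩)
    · exact ⟨x.u, x.v, Or.inr ((SimpleGraph.edge_adj ..).2 ⟨Or.inl ⟨rfl, rfl⟩, x.ne⟩), rfl⟩
    · exact ⟨a, b, Or.inl hab, rfl⟩

theorem codes_apply_del {n : ℕ} (G : SimpleGraph (Fin n)) {x : EdgeUpdate n}
    (hx : x.ins = false) : codes (x.apply G) = (codes G).erase (edgeCode n x.u x.v) := by
  ext e
  rw [mem_erase, mem_codes, mem_codes, EdgeUpdate.apply, if_neg (by simp [hx])]
  constructor
  · rintro ⟨a, b, hab, rfl⟩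
    rw [SimpleGraph.sdiff_adj, SimpleGraph.edge_adj] at hab
    refine ⟨fun h => hab.2 ⟨edgeCode_eq_iff.1 h, hab.1.ne⟩, a, b, hab.1, rfl⟩
  · rintro ⟨hne, a, b, hab, rfl⟩
    refine ⟨a, b, ?_, rfl⟩
    rw [SimpleGraph.sdiff_adj, SimpleGraph.edge_adj]
    exact ⟨hab, fun h => hne (edgeCode_eq_iff.2 h.1)⟩

/-- A cover is a set of vertices, so it has at most `n` elements; this justifies replacing `k` by
`min k n`. -/
theorem exists_cover_codes {n k : ℕ} {G : SimpleGraph (Fin n)} {T : Finset (Fin n)}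
    (hT : #T ≤ k) (hG : G.IsVertexCover T) :
    ∃ T' : Finset ℕ, #T' ≤ min k n ∧ (∀ t ∈ T', t < n) ∧
      ∀ e ∈ codes G, e / n ∈ T' ∨ e % n ∈ T' := by
  refine ⟨T.map Fin.valEmbedding, ?_, ?_, ?_⟩
  · rw [card_map]
    exact le_min hT (by simpa using card_le_univ T)
  · intro t ht
    obtain ⟨a, -, rfl⟩ := mem_map.1 ht
    exact a.2
  · intro e he
    obtain ⟨u, v, huv, rfl⟩ := mem_codes.1 he
    rw [edgeCode_div u.2 v.2, edgeCode_mod u.2 v.2]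
    have hmem : ∀ w : Fin n, w ∈ T → (w : ℕ) ∈ T.map Fin.valEmbedding :=
      fun w hw => mem_map_of_mem _ hw
    rcases hG huv with h | h
    · rcases le_total (u : ℕ) v with h' | h'
      · exact Or.inl (by rw [min_eq_left h']; exact hmem u h)
      · exact Or.inr (by rw [max_eq_left h']; exact hmem u h)
    · rcases le_total (u : ℕ) v with h' | h'
      · exact Or.inr (by rw [max_eq_right h']; exact hmem v h)
      · exact Or.inl (by rw [min_eq_right h']; exact hmem v h)

theorem graphAfter_append_singleton {n : ℕ} (S : List (EdgeUpdate n)) (x : EdgeUpdate n) :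
    graphAfter (S ++ [x]) = x.apply (graphAfter S) := by
  simp [graphAfter, List.foldl_append]

/-- The promise is used for the prefix ending with `x`: the rebuilt list has to cover the new edge,
too. -/
theorem transition_of_stream {n k : ℕ} {S₁ S₂ : List (EdgeUpdate n)} {x : EdgeUpdate n}
    (hS : IsDynamicStream (S₁ ++ x :: S₂)) (hk : VertexCoverPromise k (S₁ ++ x :: S₂)) :
    Transition n (min k n) (if x.ins then 1 else 0) x.u x.v (codes (graphAfter S₁))
      (codes (graphAfter (S₁ ++ [x]))) := by
  have h1 := hS S₁.length (by simp)
  simp only [List.getElem_append_right le_rfl, Nat.sub_self, List.getElem_cons_zero,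
    List.take_left] at h1
  obtain ⟨T, hT, hcov⟩ := hk (S₁.length + 1) (by simp)
  have htake : (S₁ ++ x :: S₂).take (S₁.length + 1) = S₁ ++ [x] := by
    simp [List.take_append]
  rw [htake] at hcov
  rw [graphAfter_append_singleton] at hcov ⊢
  by_cases hx : x.ins = true
  · refine Or.inl ⟨by simp [hx], ?_, codes_apply_ins _ hx, exists_cover_codes hT hcov⟩
    rw [edgeCode_mem_codes]
    exact h1.1 hx
  · refine Or.inr ⟨by simp [hx], ?_, codes_apply_del _ (by simpa using hx)⟩
    rw [edgeCode_mem_codes]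
    by_contra hc
    exact hx (h1.2 hc)

/-! ### Runs of the algorithm -/

theorem initCmd_within : initCmd.Within 36 := by
  simp [initCmd, primeCmd, powCmd, Cmd.Within, put]

theorem updateCmd_within : updateCmd.Within 36 := by
  simp [updateCmd, rebuildCmd, separateCmd, decodeCmd, coverCmd, loadCmd, findCmd, sketchCmd,
    Cmd.Within, put]

/-- A bound for the weights of the commands of the algorithm. -/
def algorithmWeight : ℕ := max (max initCmd.weight updateCmd.weight) extractWeight

/-- The algorithm. -/
def coverAlgorithm : StreamAlgorithm := ⟨initCmd, updateCmd, extractCmd⟩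

/-- In the state `s`, the memory represents the graph `G`. -/
structure Maintains {n : ℕ} (k p B : ℕ) (G : SimpleGraph (Fin n)) (s : State) : Prop where
  ready : Ready n k p s.mem
  represents : Represents n k p (codes G) (s.mem cell_H) (s.mem cell_S)
  bounded : Bounded 36 B s.mem
  out_eq : s.out = []
  peak_le : s.peak ≤ spaceBound 36 B algorithmWeight

theorem WP.exists_exec {B w : ℕ} {p : Cmd} {Q : (ℕ →₀ ℕ) → Prop} {s : State}
    (h : WP B p Q s.mem) (ω : ℕ → Bool) (hp : p.Within 36) (hw : p.weight ≤ w)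
    (hs : Bounded 36 B s.mem) :
    ∃ t, Exec ω p s t ∧ Q t.mem ∧ (∀ a, p.keeps a = true → t.mem a = s.mem a) ∧
      t.out = s.out ∧ Bounded 36 B t.mem ∧ t.peak ≤ max s.peak (spaceBound 36 B w) := by
  obtain ⟨M', h1, h2⟩ := h
  obtain ⟨t, h3, rfl, h4, h5, h6⟩ := h1.reaches ω hp hw hs s rfl
  exact ⟨t, h3, h2, fun a ha => h1.frame ha, h4, h5, h6⟩

theorem Bounded.memBits_le_spaceBound {B w : ℕ} {M : ℕ →₀ ℕ} (h : Bounded 36 B M) :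
    memBits M ≤ spaceBound 36 B w := h.memBits_le.trans (Nat.le_add_right _ _)

theorem Maintains.update {n k p B : ℕ} (hP : Params n k p B) {G G' : SimpleGraph (Fin n)}
    {s : State} (hs : Maintains k p B G s) (ω : ℕ → Bool) (x : EdgeUpdate n)
    (htr : Transition n k (if x.ins then 1 else 0) x.u x.v (codes G) (codes G')) :
    ∃ t, Exec ω updateCmd (s.feed x) t ∧ Maintains k p B G' t := by
  have hn := hP.two_le
  have hnp : n ≤ p := (Nat.le_mul_self n).trans (by have := hP.le_p; omega)
  have hb1 : Bounded 36 B (s.mem.update cell_ins (if x.ins then 1 else 0)) := by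
    refine hs.bounded.update (by decide) (hP.lt_of_le_p ?_)
    split_ifs <;> omega
  have hb2 := hb1.update (a := cell_u) (v := x.u) (by decide)
    (hP.lt_of_le_p (by have := x.u.2; omega))
  have hb3 := hb2.update (a := cell_v) (v := x.v) (by decide)
    (hP.lt_of_le_p (by have := x.v.2; omega))
  have hmem : (s.feed x).mem = ((s.mem.update cell_ins (if x.ins then 1 else 0)).update
      cell_u x.u).update cell_v x.v := rfl
  have hpeak : (s.feed x).peak ≤ spaceBound 36 B algorithmWeight := by
    refine max_le (max_le (max_le hs.peak_le ?_) ?_) ?_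
    exacts [hb1.memBits_le_spaceBound, hb2.memBits_le_spaceBound, hb3.memBits_le_spaceBound]
  rw [← hmem] at hb3
  have hwp := updateCmd_spec hP (M := (s.feed x).mem) (E := codes G) (E' := codes G')
    (hs.ready.of_eq (by simp [hmem]) (by simp [hmem]) (by simp [hmem]) (by simp [hmem])
      (by simp [hmem]) (by simp [hmem]) (by simp [hmem]))
    (isCodes_codes G) (by simpa [hmem] using hs.represents) (hb3.1 _) (hb3.1 _)
    (by simp [hmem]) (by simp [hmem]) (by
      simp only [hmem]
      simpa [Fin.ext_iff] using x.ne) (by simpa [hmem] using htr)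
  obtain ⟨t, h1, ⟨h2, h3⟩, -, h4, h5, h6⟩ := hwp.exists_exec ω updateCmd_within
    (w := algorithmWeight) (le_max_of_le_left (le_max_right _ _)) hb3
  exact ⟨t, h1, h2, h3, h5, h4.trans hs.out_eq, h6.trans (max_le hpeak le_rfl)⟩

theorem Maintains.pass {n k p B : ℕ} (hP : 2 ≤ n → Params n (min k n) p B) (ω : ℕ → Bool)
    {S : List (EdgeUpdate n)} (hS : IsDynamicStream S) (hk : VertexCoverPromise k S) :
    ∀ (S₁ S₂ : List (EdgeUpdate n)), S = S₁ ++ S₂ → ∀ s, Maintains (min k n) p B (graphAfter S₁) s →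
      ∃ t, Pass ω updateCmd S₂ s t ∧ Maintains (min k n) p B (graphAfter S) t := by
  intro S₁ S₂
  induction S₂ generalizing S₁ with
  | nil =>
    rintro rfl s hs
    rw [List.append_nil]
    exact ⟨s, .nil s, hs⟩
  | cons x S₂ ih =>
    rintro rfl s hs
    -- An update has two distinct ends, so `Params` is needed only for `n ≥ 2`; for `n = 1` the
    -- stream is empty.
    have hn : 2 ≤ n := by
      have h1 := x.u.2
      have h2 := x.v.2
      have h3 : (x.u : ℕ) ≠ x.v := fun h => x.ne (Fin.ext h)
      omega
    obtain ⟨t, h1, h2⟩ := hs.update (hP hn) ω x (transition_of_stream hS hk)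
    obtain ⟨u, h3, h4⟩ := ih (S₁ ++ [x]) (by simp) t h2
    exact ⟨u, .cons h1 h3, h4⟩

/-- Every edge is hit by a digit of `H`. Unused digits are `0` and print the vertex `0`, which does
no harm since only the length of the list is limited. -/
theorem isSolution_of_represents {n k p H S : ℕ} (hn : 1 ≤ n) {G : SimpleGraph (Fin n)}
    (h : Represents n (min k n) p (codes G) H S) :
    IsSolution k G ((List.range (min k n)).map fun i => H / n ^ i % n) := by
  refine ⟨by simp, ?_, ?_⟩
  · intro a ha
    obtain ⟨i, -, rfl⟩ := List.mem_map.1 ha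
    exact Nat.mod_lt _ (by omega)
  · intro u v huv
    have hlt := h.firstHit_lt _ (edgeCode_mem_codes.2 huv)
    have hhit := hit_firstHit hlt
    rw [Hit, edgeCode_div u.2 v.2, edgeCode_mod u.2 v.2] at hhit
    have hmem : H / n ^ firstHit n (edgeCode n u v) (min k n) H % n ∈
        (List.range (min k n)).map fun i => H / n ^ i % n :=
      List.mem_map.2 ⟨_, List.mem_range.2 hlt, rfl⟩
    have : H / n ^ firstHit n (edgeCode n u v) (min k n) H % n = u ∨
        H / n ^ firstHit n (edgeCode n u v) (min k n) H % n = v := by omega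
    rcases this with h | h <;> rw [h] at hmem
    exacts [Or.inl hmem, Or.inr hmem]

/-- The length of the cells used by the algorithm. -/
def cellBits (n k D : ℕ) : ℕ :=
  (2 * n.size + 1) * (2 * ((2 * min k n + 1) * (min k n + 3))) + D.size + k.size + 1

/-- The exponent of `p` in the largest power is `2 * (2k + 1) * (k + 3)`, with `k` capped at `n`,
and `p` has `O(log n)` bits; this is the source of the space `k ^ 2 * log n`. -/
theorem sketchBase_lt_cellBits {n : ℕ} (hn : 1 ≤ n) (k D : ℕ) :
    sketchBase (2 * (n * n + 1)) (min k n) ^ (min k n + 3) < 2 ^ cellBits n k D := by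
  have h1 : 2 * (n * n + 1) ≤ 2 ^ (2 * n.size + 1) := by
    have := Nat.lt_size_self n
    have h : (n + 1) * (n + 1) ≤ 2 ^ n.size * 2 ^ n.size := Nat.mul_le_mul this this
    rw [← pow_add, ← two_mul] at h
    rw [pow_succ]
    nlinarith
  rw [sketchBase, ← pow_two, ← pow_mul, ← pow_mul]
  calc _ ≤ (2 ^ (2 * n.size + 1)) ^ (2 * ((2 * min k n + 1) * (min k n + 3))) :=
        Nat.pow_le_pow_left h1 _
    _ = 2 ^ ((2 * n.size + 1) * (2 * ((2 * min k n + 1) * (min k n + 3)))) := (pow_mul ..).symm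
    _ < _ := Nat.pow_lt_pow_right (by norm_num) (by unfold cellBits; omega)

theorem lt_two_pow_cellBits {x n k D : ℕ} (h : x.size ≤ cellBits n k D) :
    x < 2 ^ cellBits n k D := Nat.size_le.1 h

/-- The summands `D.size` and `k.size` of `cellBits` make room for the input parameters; the given
`k` may exceed `n`. -/
theorem bounded_startState (n k D : ℕ) : Bounded 36 (cellBits n k D) (startState n k D).mem := by
  have hn : n.size ≤ cellBits n k D := by
    have : 2 * n.size + 1 ≤ (2 * n.size + 1) * (2 * ((2 * min k n + 1) * (min k n + 3))) :=
      Nat.le_mul_of_pos_right _ (by positivity)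
    unfold cellBits
    omega
  have h0 : Bounded 36 (cellBits n k D) (Finsupp.single 0 n) := by
    constructor
    · intro a
      rw [Finsupp.single_apply]
      split_ifs
      · exact lt_two_pow_cellBits hn
      · positivity
    · intro a ha
      rw [Finsupp.single_apply, if_neg (by omega)]
  refine (h0.update (by decide) (lt_two_pow_cellBits ?_)).update (by decide)
    (lt_two_pow_cellBits ?_) <;> (unfold cellBits; omega)

/-- The algorithm outputs a vertex cover, for every outcome of the coins. -/
theorem coverAlgorithm_run {n k : ℕ} (hn : 1 ≤ n) (D : ℕ) {S : List (EdgeUpdate n)}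
    (hS : IsDynamicStream S) (hk : VertexCoverPromise k S) (ω : ℕ → Bool) :
    ∃ s t, coverAlgorithm.Run ω k D S s t ∧ IsSolution k (graphAfter S) t.out ∧
      t.peak ≤ spaceBound 36 (cellBits n k D) algorithmWeight ∧
      t.time ≤ s.time + (4 * k + 2) * (extractWeight * (cellBits n k D + 1)) := by
  have hb := bounded_startState n k D
  have e0 : (startState n k D).mem cell_n = n := by simp [startState]
  have e1 : (startState n k D).mem cell_k = k := by simp [startState]
  have e2 : (startState n k D).mem cell_H = 0 := by simp [startState]
  have e3 : (startState n k D).mem cell_S = 0 := by simp [startState]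
  have hinit := initCmd_spec (B := cellBits n k D) rfl hn e0 e1 (sketchBase_lt_cellBits hn k D)
    (by have := hb.1 cell_n; rwa [e0] at this)
  obtain ⟨r, h1, ⟨p, hR, hp, hnp, hB⟩, hf, h2, h3, h4⟩ := hinit.exists_exec ω initCmd_within
    (w := algorithmWeight) (le_max_of_le_left (le_max_left _ _)) hb
  -- Zero as list and zero as packed sketch represent the graph without edges.
  have hr : Maintains (min k n) p (cellBits n k D) (graphAfter ([] : List (EdgeUpdate n))) r := by
    have hcodes : codes (graphAfter ([] : List (EdgeUpdate n))) = ∅ := by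
      ext e
      simp [mem_codes, graphAfter]
    refine ⟨hR, ⟨?_, ?_⟩, h3, h2, h4.trans (max_le hb.memBits_le_spaceBound le_rfl)⟩
    · rw [hf _ (by decide), e3, hcodes]
      simp [loadSum]
    · simp [hcodes]
  obtain ⟨s, h5, hs⟩ := Maintains.pass (fun h => ⟨h, min_le_right _ _, hp, hnp, hB⟩) ω hS hk
    [] S rfl r hr
  obtain ⟨t, h6, h7, h8, h9⟩ := extractCmd_spec (ω := ω) hs.bounded hs.ready.hn hs.ready.hk
  refine ⟨s, t, ⟨r, h1, h5, h6⟩, ?_, ?_, ?_⟩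
  · rw [h7, hs.out_eq, List.nil_append]
    exact isSolution_of_represents hn hs.represents
  · exact h9.trans (max_le hs.peak_le (spaceBound_mono (le_max_right _ _)))
  · refine h8.trans (Nat.add_le_add_left (Nat.mul_le_mul_right _ ?_) _)
    have := min_le_left k n
    omega

/-! ### Asymptotics -/

/-- The length exceeds the binary logarithm by at most one, and `log 2 > 1 / 2`. -/
theorem size_le_of_le {x : ℕ} {y : ℝ} (hx : 1 ≤ x) (hxy : (x : ℝ) ≤ y) :
    (x.size : ℝ) ≤ 1 + 2 * Real.log y := by
  have hs : 0 < x.size := Nat.size_pos.2 hx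
  have h1 : 2 ^ (x.size - 1) ≤ x := Nat.lt_size.1 (by omega)
  have h2 : ((2 : ℝ) ^ (x.size - 1)) ≤ y := le_trans (by exact_mod_cast h1) hxy
  have h3 := Real.log_le_log (by positivity) h2
  rw [Real.log_pow, Nat.cast_sub hs, Nat.cast_one] at h3
  have h4 := Real.log_two_gt_d9
  have h5 : (1 : ℝ) ≤ x.size := by exact_mod_cast hs
  nlinarith

/-- With `K = max k 1` and `L = log (n / δ)`, the main term is at most `(3 + 4 * L) * 24 * K ^ 2`;
the constant `150` leaves room for the lengths of the parameters. -/
theorem cellBits_le {n k : ℕ} {δ : ℝ} (hn : 1 ≤ n) (h0 : 0 < δ) (h1 : δ < 1) :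
    (cellBits n k ⌈1 / δ⌉₊ : ℝ) + 1 ≤
      150 * (max k 1 : ℝ) ^ 2 * (1 + Real.log (n / δ)) := by
  have hn' : (1 : ℝ) ≤ n := by exact_mod_cast hn
  have hδ : 1 ≤ 1 / δ := by rw [le_div_iff₀ h0]; linarith
  have hle : (n : ℝ) ≤ n / δ := by
    rw [le_div_iff₀ h0]
    nlinarith
  have hle' : 1 / δ ≤ n / δ := by gcongr
  set L := Real.log (n / δ) with hL
  have hL0 : 0 ≤ L := Real.log_nonneg (hδ.trans hle')
  have hsn : (n.size : ℝ) ≤ 1 + 2 * L := size_le_of_le hn hle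
  have hD1 : 1 ≤ ⌈1 / δ⌉₊ := Nat.one_le_ceil_iff.2 (by linarith)
  have hD2 : (⌈1 / δ⌉₊ : ℝ) ≤ 2 * (n / δ) := by
    have := (Nat.ceil_lt_add_one (by linarith : 0 ≤ 1 / δ)).le
    linarith
  have hsD : ((⌈1 / δ⌉₊).size : ℝ) ≤ 3 + 2 * L := by
    have := size_le_of_le hD1 hD2
    rw [Real.log_mul (by norm_num) (by positivity)] at this
    have := Real.log_two_lt_d9
    linarith
  set K : ℝ := max k 1 with hK
  have hK1 : 1 ≤ K := le_max_right _ _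
  have hkK : (k : ℝ) ≤ K := le_max_left _ _
  have hsk : (k.size : ℝ) ≤ K := by
    have : k.size ≤ k := Nat.size_le.2 Nat.lt_two_pow_self
    exact le_trans (by exact_mod_cast this) hkK
  have hm : ((min k n : ℕ) : ℝ) ≤ K := le_trans (by exact_mod_cast min_le_left k n) hkK
  have hm0 : (0 : ℝ) ≤ ((min k n : ℕ) : ℝ) := Nat.cast_nonneg _
  have hprod : (2 * ((min k n : ℕ) : ℝ) + 1) * (((min k n : ℕ) : ℝ) + 3) ≤ 12 * K ^ 2 := by
    nlinarith
  have hmain : (2 * (n.size : ℝ) + 1) *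
      (2 * ((2 * ((min k n : ℕ) : ℝ) + 1) * (((min k n : ℕ) : ℝ) + 3))) ≤
      (3 + 4 * L) * (2 * (12 * K ^ 2)) :=
    mul_le_mul (by linarith) (by linarith) (by positivity) (by positivity)
  have hKK : K ≤ K ^ 2 := by nlinarith
  have hK2 : (1 : ℝ) ≤ K ^ 2 := by nlinarith
  have hLK : L ≤ K ^ 2 * L := by nlinarith
  unfold cellBits
  push_cast at hmain ⊢
  nlinarith

/-- Extraction takes about `k` rounds on cells of about `k ^ 2 * log (n / δ)` bits; the resulting
cube disappears in the allowed exponential. -/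
theorem cube_le (k : ℕ) : (max k 1 : ℝ) ^ 3 ≤ 2 ^ (2 * k ^ 2) := by
  rcases Nat.eq_zero_or_pos k with rfl | hk
  · simp
  · have h1 : (1 : ℝ) ≤ k := by exact_mod_cast hk
    rw [max_eq_left h1]
    have h2 : k ^ 2 < 2 ^ (k ^ 2) := Nat.lt_two_pow_self
    have h3 : ((k : ℝ)) ^ 2 ≤ 2 ^ (k ^ 2) := by exact_mod_cast h2.le
    have h4 : (k : ℝ) ≤ 2 ^ (k ^ 2) := by nlinarith
    calc (k : ℝ) ^ 3 = k * k ^ 2 := by ring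
      _ ≤ 2 ^ (k ^ 2) * 2 ^ (k ^ 2) := by gcongr
      _ = 2 ^ (2 * k ^ 2) := by rw [two_mul, pow_add]

end StreamRAM

/-! ### The main theorem. -/

theorem mainTheorem3 (c : ℕ) :
    ∃ (A : StreamRAM.StreamAlgorithm) (C d : ℕ),
      ∀ (n k : ℕ) (δ : ℝ), 1 ≤ n → 0 < δ → δ < 1 →
      ∀ S : List (StreamRAM.EdgeUpdate n),
        StreamRAM.IsDynamicStream S → S.length ≤ n ^ c → StreamRAM.VertexCoverPromise k S →
        (∀ ω : ℕ → Bool, ∃ s t : StreamRAM.State,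
          A.Run ω k ⌈1 / δ⌉₊ S s t ∧
          (t.peak : ℝ) ≤ C * (max k 1 : ℝ) ^ 2 * (1 + Real.log (n / δ)) ^ d ∧
          (t.time : ℝ) - s.time ≤ C * 2 ^ (2 * k ^ 2) * (1 + Real.log (n / δ)) ^ d) ∧
        ENNReal.ofReal (1 - δ / (n : ℝ) ^ c) ≤
          StreamRAM.coinMeasure {ω | ∃ s t : StreamRAM.State,
            A.Run ω k ⌈1 / δ⌉₊ S s t ∧
            StreamRAM.IsSolution k (StreamRAM.graphAfter S) t.out} := by
  open StreamRAM in
  -- Here `1332 = 36 * 37` pays for the 36 cells and `algorithmWeight` for the working storage. The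
  -- term `6 * extractWeight` pays for the extraction, as `4 * k + 2 ≤ 6 * max k 1`, and `150` comes
  -- from `cellBits_le`.
  refine ⟨coverAlgorithm, (1332 + algorithmWeight + 6 * extractWeight) * 150, 1, ?_⟩
  intro n k δ hn h0 h1 S hS _ hk
  have hrun := coverAlgorithm_run hn ⌈1 / δ⌉₊ hS hk
  unfold spaceBound at hrun
  generalize algorithmWeight = W at hrun ⊢
  generalize extractWeight = W' at hrun ⊢
  have hbits := cellBits_le (k := k) hn h0 h1
  constructor
  · intro ω
    obtain ⟨s, t, hst, -, hpeak, htime⟩ := hrun ω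
    refine ⟨s, t, hst, ?_, ?_⟩
    · have hpeak' : (t.peak : ℝ) ≤
          36 * (36 + cellBits n k ⌈1 / δ⌉₊) + W * (cellBits n k ⌈1 / δ⌉₊ + 1) := by
        exact_mod_cast hpeak
      have hb0 : (0 : ℝ) ≤ cellBits n k ⌈1 / δ⌉₊ := Nat.cast_nonneg _
      push_cast
      rw [pow_one]
      calc (t.peak : ℝ) ≤ (1332 + W + 6 * W') *
            (cellBits n k ⌈1 / δ⌉₊ + 1) := by
            have : (0 : ℝ) ≤ W' * (cellBits n k ⌈1 / δ⌉₊ + 1) := by positivity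
            nlinarith
        _ ≤ (1332 + W + 6 * W') *
            (150 * (max k 1 : ℝ) ^ 2 * (1 + Real.log (n / δ))) := by gcongr
        _ = _ := by ring
    · have htime' : (t.time : ℝ) ≤
          s.time + (4 * k + 2) * (W' * (cellBits n k ⌈1 / δ⌉₊ + 1)) := by
        exact_mod_cast htime
      have hlog : 0 ≤ 1 + Real.log (n / δ) := by
        have : (1 : ℝ) ≤ n / δ := by
          rw [le_div_iff₀ h0]
          have : (1 : ℝ) ≤ n := by exact_mod_cast hn
          linarith
        have := Real.log_nonneg this
        linarith
      have hk6 : (4 * k + 2 : ℝ) ≤ 6 * max (k : ℝ) 1 := by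
        have h2 := le_max_left (k : ℝ) 1
        have h3 := le_max_right (k : ℝ) 1
        linarith
      push_cast
      rw [pow_one]
      calc (t.time : ℝ) - s.time ≤
            (4 * k + 2) * (W' * (cellBits n k ⌈1 / δ⌉₊ + 1)) := by linarith
        _ ≤ (6 * max (k : ℝ) 1) * (W' *
            (150 * (max k 1 : ℝ) ^ 2 * (1 + Real.log (n / δ)))) := by gcongr
        _ = (6 * W') * 150 * (max k 1 : ℝ) ^ 3 * (1 + Real.log (n / δ)) := by ring
        _ ≤ (1332 + W + 6 * W') * 150 * 2 ^ (2 * k ^ 2) *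
            (1 + Real.log (n / δ)) := by
            have h2 := cube_le k
            have h3 : (0 : ℝ) ≤ W := Nat.cast_nonneg _
            gcongr
            linarith
  -- Every tape leads to a solution, so the event is the whole space.
  · have huniv : {ω | ∃ s t : State, coverAlgorithm.Run ω k ⌈1 / δ⌉₊ S s t ∧
        IsSolution k (graphAfter S) t.out} = Set.univ := by
      refine Set.eq_univ_of_forall fun ω => ?_
      obtain ⟨s, t, hst, hsol, -⟩ := hrun ω
      exact ⟨s, t, hst, hsol⟩
    have hprob : coinMeasure Set.univ = 1 := by
      unfold coinMeasure
      exact MeasureTheory.measure_univ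
    rw [huniv, hprob]
    refine ENNReal.ofReal_le_one.2 ?_
    have : 0 ≤ δ / (n : ℝ) ^ c := by positivity
    linarith
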